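/- **Model.** Let $\beta\in[0,1)$, let $\mu$ be a probability distribution on $[0,\infty)$, and let $f:\{0,1,2,\dots\}\to\mathbb R$ be an attachment function, of which only the values at $k\ge1$ are used. Write $[x]_+=\max\{\lfloor x\rfloor,1\}$. Grow random trees $(\mathcal T(n))_{n\ge1}$, where $\mathcal T(n)$ has vertices $v_1,\dots,v_n$ and root $v_1$, as follows. $\mathcal T(1)$ is the single vertex $v_1$, and in $\mathcal T(2)$ the vertex $v_2$ is joined to $v_1$. For $n\ge2$, given $\mathcal T(n)$, sample $\xi_{n+1}\sim\mu$ independently of $\mathcal T(n)$ and put $m=[\,n-n^{\beta}\xi_{n+1}]_+$; conditionally on $\mathcal T(n)$ and $\xi_{n+1}$, the new vertex $v_{n+1}$ is joined by an edge to a vertex $v$ of $\mathcal T(m)$ chosen with probability proportional to $f(\deg(v,m))$. Here $\deg(v,m)$ is the degree of $v$ in $\mathcal T(m)$, with the convention $\deg(v_1,1)=1$. Let $Z_k(n)$ be the number of vertices of degree $k$ in $\mathcal T(n)$ and $$\Psi(n)=\sum_{v\in\mathcal T(n)}f(\deg(v,n)).$$ **Assumptions.** 1. $\inf_{k\ge1}f(k)>0$,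 and there is $C<\infty$ with $f(k)\le Ck$ for all $k\ge1$. 2. Let $\hat\rho(\lambda)=\sum_{k\ge1}\prod_{i=1}^{k}\frac{f(i)}{\lambda+f(i)}\in(0,\infty]$ for $\lambda>0$, and $\underline\lambda=\inf\{\lambda>0:\hat\rho(\lambda)<\infty\}$. Then $\underline\lambda<\infty$ and $\lim_{\lambda\downarrow\underline\lambda}\hat\rho(\lambda)>1$. 3. If $\xi\sim\mu$, then $\displaystyle\lim_{n\to\infty}\mathbb E\left[\frac{n^{\beta}\xi\,\mathbf 1\{n-n^{\beta}\xi\ge1\}}{[\,n-n^{\beta}\xi]_+}\right]=0.$ 4. One of the following holds: (A) for some $\alpha\in\mathbb R$, $f(k)=k+\alpha$ for all $k\ge1$; (B) $\limsup_{k\to\infty}f(k)/k=0$ and $f$ is Lipschitz on $\{1,2,\dots\}$; (C) $\limsup_{k\to\infty}f(k)/k=0$ and $f$ is non-decreasing on $\{1,2,\dots\}$. **Conclusion.** There is a unique $\lambda^*\in(0,\infty)$ with $\hat\rho(\lambda^*)=1$ (the Malthusian rate of growth), and almost surely $\Psi(n)=\sum_{k\ge1}f(k)Z_k(n)$ for all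 $n\ge1$ and $$\frac{\Psi(n)}{n}=\sum_{k=1}^{\infty}f(k)\,\frac{Z_k(n)}{n}\longrightarrow\lambda^*\qquad(n\to\infty).$$ -/

import Mathlib

open Filter Topology MeasureTheory ProbabilityTheory

namespace DelayPA

noncomputable section

/-! A growing tree on the vertices `1, 2, 3, …` (rooted at `1`) is encoded by its parent map
`p : ℕ → ℕ`: for `j ≥ 2`, the vertex `j` enters at time `j` and is joined to the vertex `p j`.
The labelled tree at time `n` has vertices `1, …, n` and edges `{j, p j}`, `2 ≤ j ≤ n`; it is
given by the restriction of `p` to `{2, …, n}`. -/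

/-- The number of children (the in-degree) of the vertex `i` at time `n`. -/
def children (p : ℕ → ℕ) (i n : ℕ) : ℕ :=
  ((Finset.Icc 2 n).filter fun j => p j = i).card

/-- The degree at time `n` of the vertex `i`, for `1 ≤ i ≤ n`: it is in-degree plus one for a
vertex other than the root, and the in-degree for the root as soon as there is an edge. The degree
of the root in the tree with the single vertex `1` is by convention equal to `1`. -/
def deg (p : ℕ → ℕ) (i n : ℕ) : ℕ :=
  if i = 1 ∧ 2 ≤ n then children p i n else children p i n + 1

/-- The number of vertices of degree `k` at time `n`. -/
def degCount (p : ℕ → ℕ) (k n : ℕ) : ℕ :=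
  ((Finset.Icc 1 n).filter fun i => deg p i n = k).card

/-- The total attachment weight of the tree at time `n`. -/
def totalWeight (f : ℕ → ℝ) (p : ℕ → ℕ) (n : ℕ) : ℝ :=
  ∑ i ∈ Finset.Icc 1 n, f (deg p i n)

/-- The probability of choosing the vertex `i` when a vertex of the tree at time `m` is chosen
with probability proportional to `f` of its degree at time `m`. -/
def attachProb (f : ℕ → ℝ) (p : ℕ → ℕ) (m i : ℕ) : ℝ :=
  if i ∈ Finset.Icc 1 m then f (deg p i m) / totalWeight f p m else 0

/-- The time `max {⌊n - n ^ β x⌋, 1}` whose tree is visible at time `n` with normalized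
delay `x`. -/
def snapshot (β : ℝ) (n : ℕ) (x : ℝ) : ℕ :=
  max ⌊(n : ℝ) - (n : ℝ) ^ β * x⌋₊ 1

/-- The random labelled tree at time `n`, as the family of the parents of `2, …, n`. It determines
the trees at all earlier times. -/
def treeAt {Ω : Type*} (par : ℕ → Ω → ℕ) (n : ℕ) (ω : Ω) : Finset.Icc 2 n → ℕ :=
  fun j => par j ω

/-- The random growing tree with random parent map `par` and normalized delays `ξ` evolves
according to the network model with time scale parameter `β`, delay distribution `μ` and attachment
function `f`: vertex `2` is attached to vertex `1`; at each time `n + 1 ≥ 3` the delay `ξ (n + 1)`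
has law `μ` and is independent of the tree at time `n`, and conditionally on the tree at time `n`
and on this delay, the vertex `n + 1` is attached to a vertex `i` of the tree at time
`snapshot β n (ξ (n + 1))` with probability proportional to `f` of its degree at that time. -/
structure IsDelayTree {Ω : Type*} [MeasurableSpace Ω] (P : Measure Ω) (β : ℝ) (μ : Measure ℝ)
    (f : ℕ → ℝ) (ξ : ℕ → Ω → ℝ) (par : ℕ → Ω → ℕ) : Prop where
  measurable_delay : ∀ n, Measurable (ξ n)
  measurable_par : ∀ n, Measurable (par n)
  par_two : ∀ᵐ ω ∂P, par 2 ω = 1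
  law_delay : ∀ n, 2 ≤ n → P.map (ξ (n + 1)) = μ
  indep_delay : ∀ n, 2 ≤ n → IndepFun (ξ (n + 1)) (treeAt par n) P
  attach : ∀ n, 2 ≤ n → ∀ i,
    P[({ω | par (n + 1) ω = i}.indicator fun _ => (1 : ℝ)) |
        MeasurableSpace.comap (fun ω => (treeAt par n ω, ξ (n + 1) ω)) inferInstance]
      =ᵐ[P] fun ω => attachProb f (fun j => par j ω) (snapshot β n (ξ (n + 1) ω)) i

/-- `ρ̂(l) = ∑_{k ≥ 1} ∏_{i = 1}^{k} f(i) / (l + f(i))`, with values in `[0, ∞]`. -/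
def rhoHat (f : ℕ → ℝ) (l : ℝ) : ENNReal :=
  ∑' k : ℕ, ∏ i ∈ Finset.Icc 1 (k + 1), ENNReal.ofReal (f i / (l + f i))

/-- The set of the `l > 0` at which `ρ̂` is finite. -/
def finiteSet (f : ℕ → ℝ) : Set ℝ := {l | 0 < l ∧ rhoHat f l < ⊤}

/-- The basic assumptions on the attachment function (only its values at `k ≥ 1` matter). The
infimum `sInf (finiteSet f)` is taken over a nonempty set of positive reals. -/
structure AttachAssumption (f : ℕ → ℝ) : Prop where
  inf_pos : ∃ c > 0, ∀ k, 1 ≤ k → c ≤ f k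
  linear_growth : ∃ C : ℝ, ∀ k : ℕ, 1 ≤ k → f k ≤ C * k
  finite_somewhere : (finiteSet f).Nonempty
  limit_gt_one : ∃ L : ENNReal, Tendsto (rhoHat f) (𝓝[>] (sInf (finiteSet f))) (𝓝 L) ∧ 1 < L

/-- `f(k) = k + α` for all `k ≥ 1`. -/
def IsAffine (f : ℕ → ℝ) : Prop := ∃ α : ℝ, ∀ k : ℕ, 1 ≤ k → f k = k + α

/-- `f(k) / k → 0`; for positive `f` this says that the upper limit of `f(k) / k` is `0`. -/
def IsSublinear (f : ℕ → ℝ) : Prop := Tendsto (fun k : ℕ => f k / k) atTop (𝓝 0)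

/-- `f` is Lipschitz on the positive integers. -/
def IsLipschitz (f : ℕ → ℝ) : Prop :=
  ∃ L : ℝ, ∀ i j : ℕ, 1 ≤ i → 1 ≤ j → |f i - f j| ≤ L * |(i : ℝ) - j|

/-- `f` is non-decreasing on the positive integers. -/
def IsNondecreasing (f : ℕ → ℝ) : Prop := ∀ i j : ℕ, 1 ≤ i → i ≤ j → f i ≤ f j

/-- One of the three regimes of attachment functions. -/
def AttachRegime (f : ℕ → ℝ) : Prop :=
  IsAffine f ∨ (IsSublinear f ∧ IsLipschitz f) ∨ (IsSublinear f ∧ IsNondecreasing f)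

/-- `E[n ^ β ξ 1{n - n ^ β ξ ≥ 1} / max {⌊n - n ^ β ξ⌋, 1}] → 0` for `ξ` with law `μ`. -/
def DelayAssumption (β : ℝ) (μ : Measure ℝ) : Prop :=
  Tendsto (fun n : ℕ => ∫ x, ({x : ℝ | 1 ≤ (n : ℝ) - (n : ℝ) ^ β * x}.indicator
      fun x => (n : ℝ) ^ β * x / (snapshot β n x : ℝ)) x ∂μ) atTop (𝓝 0)

end

end DelayPA

namespace DelayPA

/-! ### The Laplace transform `rhoHat` -/

section RhoHat

variable {f : ℕ → ℝ}

/-! Every term of `ρ̂` decreases strictly in `λ`, so the equation `ρ̂(λ) = 1` has at most one root;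
the intermediate value theorem provides one. For affine `f` the degree sum gives `Ψ(n) = (2 + α) n -
2` for `n ≥ 2`, and `ρ̂(2 + α) = 1` by telescoping. The rest treats `f(k) = o(k)`.

Let `N_k(n)` be the number of vertices of degree greater than `k`, so `N_0(n) = n`, and put `φ_0 =
Ψ`, `φ_k = f(k) Z_k` for `k ≥ 1`. From time 2 on, `N_k` (`k ≥ 1`) grows by one exactly when the new
vertex joins a vertex of degree `k`. Since `β < 1`, a fixed normalized delay hides only `o(n)`
vertices, and sublinearity makes `Ψ` insensitive to them; hence the conditional probability of this
event is `φ_k / Ψ + o(1)`, uniformly over trees (`eventually_meanAttach_sub_le`). The centred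
increments are bounded and orthogonal to the past, so their sums are `o(n)`
(`ae_isLittleO_sum_of_orthogonal`). Almost surely the path then satisfies the deterministic
`FluidData`.

Let `L` be the upper limit of `Ψ(n)/n` and `w_k = φ_k - L N_k`. By definition `w_0 ≤ o(n)`, and up
to the error terms `w_k` has drift `f(k) (w_{k-1} - w_k) / Ψ`, so `w_k ≤ o(n)` for every `k`
(`FluidData.flux_bound`). Summed over `k ≥ 1`, the `φ_k` give `Ψ` and the `N_k` give `n + o(n)`, so
the `w_k` sum to `w_0 + o(n)`, which is `o(n)` along times where `Ψ(n)/n → L`. Quantities bounded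
above by `o(n)` with such a sum are all `o(n)`: along these times `N_k / N_{k-1} → f(k) / (L +
f(k))`, and `∑ N_k / n → 1` becomes `ρ̂(L) = 1` (`FluidData.hasSum_of_mapClusterPt`). The lower
limit is treated with signs reversed, and uniqueness of the root identifies both. -/

theorem rhoTerm_nonneg (hf : ∀ k, 1 ≤ k → 0 < f k) {l : ℝ} (hl : 0 < l) (k : ℕ) :
    0 ≤ ∏ i ∈ Finset.Icc 1 k, f i / (l + f i) :=
  Finset.prod_nonneg fun i hi => by
    have := hf i (Finset.mem_Icc.1 hi).1
    positivity

theorem rhoHat_eq (hf : ∀ k, 1 ≤ k → 0 < f k) {l : ℝ} (hl : 0 < l) :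
    rhoHat f l = ∑' k : ℕ, ENNReal.ofReal (∏ i ∈ Finset.Icc 1 (k + 1), f i / (l + f i)) := by
  refine tsum_congr fun k => (ENNReal.ofReal_prod_of_nonneg fun i hi => ?_).symm
  have := hf i (Finset.mem_Icc.1 hi).1
  positivity

theorem rhoHat_eq_one_iff (hf : ∀ k, 1 ≤ k → 0 < f k) {l : ℝ} (hl : 0 < l) :
    rhoHat f l = 1 ↔ HasSum (fun k => ∏ i ∈ Finset.Icc 1 (k + 1), f i / (l + f i)) 1 := by
  have h0 := fun k => rhoTerm_nonneg hf hl (k + 1)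
  rw [rhoHat_eq hf hl]
  constructor
  · intro h
    have hs : Summable fun k => ∏ i ∈ Finset.Icc 1 (k + 1), f i / (l + f i) := by
      have := ENNReal.summable_toReal (f := fun k =>
        ENNReal.ofReal (∏ i ∈ Finset.Icc 1 (k + 1), f i / (l + f i))) (by rw [h]; simp)
      exact this.congr fun k => ENNReal.toReal_ofReal (h0 k)
    rw [← ENNReal.ofReal_tsum_of_nonneg h0 hs, ENNReal.ofReal_eq_one] at h
    exact h ▸ hs.hasSum
  · intro h
    rw [← ENNReal.ofReal_tsum_of_nonneg h0 h.summable, h.tsum_eq, ENNReal.ofReal_one]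

theorem rhoTerm_anti (hf : ∀ k, 1 ≤ k → 0 < f k) {l l' : ℝ} (hl : 0 < l) (h : l ≤ l') (k : ℕ) :
    ∏ i ∈ Finset.Icc 1 k, f i / (l' + f i) ≤ ∏ i ∈ Finset.Icc 1 k, f i / (l + f i) := by
  refine Finset.prod_le_prod (fun i hi => ?_) fun i hi => ?_ <;>
    have := hf i (Finset.mem_Icc.1 hi).1
  · have : 0 < l' := by linarith
    positivity
  · gcongr

theorem rhoTerm_strictAnti (hf : ∀ k, 1 ≤ k → 0 < f k) {l l' : ℝ} (hl : 0 < l) (h : l < l')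
    (k : ℕ) : ∏ i ∈ Finset.Icc 1 (k + 1), f i / (l' + f i)
      < ∏ i ∈ Finset.Icc 1 (k + 1), f i / (l + f i) := by
  refine Finset.prod_lt_prod_of_nonempty (fun i hi => ?_) (fun i hi => ?_) (by simp) <;>
    have := hf i (Finset.mem_Icc.1 hi).1
  · have : 0 < l' := by linarith
    positivity
  · gcongr

theorem hasSum_rhoTerm_injective (hf : ∀ k, 1 ≤ k → 0 < f k) {l l' a : ℝ} (hl : 0 < l)
    (hl' : 0 < l') (h : HasSum (fun k => ∏ i ∈ Finset.Icc 1 (k + 1), f i / (l + f i)) a)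
    (h' : HasSum (fun k => ∏ i ∈ Finset.Icc 1 (k + 1), f i / (l' + f i)) a) : l = l' := by
  rcases lt_trichotomy l l' with hlt | heq | hlt
  · exact absurd (hasSum_lt (i := 0) (fun k => rhoTerm_anti hf hl hlt.le (k + 1))
      (rhoTerm_strictAnti hf hl hlt 0) h' h) (lt_irrefl _)
  · exact heq
  · exact absurd (hasSum_lt (i := 0) (fun k => rhoTerm_anti hf hl' hlt.le (k + 1))
      (rhoTerm_strictAnti hf hl' hlt 0) h h') (lt_irrefl _)

theorem AttachAssumption.pos (hf : AttachAssumption f) (k : ℕ) (hk : 1 ≤ k) : 0 < f k := by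
  obtain ⟨c, hc, h⟩ := hf.inf_pos
  exact hc.trans_le (h k hk)

theorem summable_rhoTerm (hf : ∀ k, 1 ≤ k → 0 < f k) {l : ℝ} (hl : 0 < l)
    (h : rhoHat f l < ⊤) :
    Summable fun k => ∏ i ∈ Finset.Icc 1 (k + 1), f i / (l + f i) := by
  rw [rhoHat_eq hf hl] at h
  exact (ENNReal.summable_toReal h.ne).congr fun k =>
    ENNReal.toReal_ofReal (rhoTerm_nonneg hf hl (k + 1))

/-- Just above the infimum of `finiteSet f` there is a point with value above 1, and to the right of
any point of finiteness the series is continuous and tends to 0. -/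
theorem exists_rhoHat_eq_one (hf : AttachAssumption f) : ∃ l, 0 < l ∧ rhoHat f l = 1 := by
  have hp := hf.pos
  obtain ⟨L, hL, hL1⟩ := hf.limit_gt_one
  obtain ⟨l₁, hgt, hmem⟩ := ((hL.eventually (lt_mem_nhds hL1)).and self_mem_nhdsWithin).exists
  obtain ⟨l₀, hl₀, hlt⟩ := exists_lt_of_csInf_lt hf.finite_somewhere hmem
  have hpos : 0 < l₀ := hl₀.1
  have hs := summable_rhoTerm hp hpos hl₀.2
  have hsum : ∀ l, l₀ ≤ l → Summable fun k => ∏ i ∈ Finset.Icc 1 (k + 1), f i / (l + f i) :=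
    fun l hl => hs.of_nonneg_of_le (fun k => rhoTerm_nonneg hp (by linarith) _)
      fun k => rhoTerm_anti hp hpos hl _
  let R : ℝ → ℝ := fun l => ∑' k, ∏ i ∈ Finset.Icc 1 (k + 1), f i / (l + f i)
  have hR1 : 1 < R l₁ := by
    rw [rhoHat_eq hp (by linarith), ← ENNReal.ofReal_tsum_of_nonneg
      (fun k => rhoTerm_nonneg hp (by linarith) _) (hsum l₁ hlt.le), ENNReal.one_lt_ofReal] at hgt
    exact hgt
  have hcont : ContinuousOn R (Set.Ici l₀) := by
    refine continuousOn_tsum (fun k => ?_) hs fun k l hl => ?_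
    · refine continuousOn_finsetProd _ fun i hi => ?_
      refine ContinuousOn.div (by fun_prop) (by fun_prop) fun l hl => ?_
      have := hp i (Finset.mem_Icc.1 hi).1
      have h3 : l₀ ≤ l := hl
      have : 0 < l := by linarith
      positivity
    · have : l₀ ≤ l := hl
      rw [Real.norm_eq_abs, abs_of_nonneg (rhoTerm_nonneg hp (by linarith) _)]
      exact rhoTerm_anti hp hpos hl _
  -- Only the factor `i = 1` is compared exactly; it alone forces decay at infinity.
  have hbound : ∀ l, l₀ ≤ l → R l ≤ (l₀ + f 1) / (l + f 1) * R l₀ := by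
    intro l hl
    have hl' : 0 < l := by linarith
    have h1 := hp 1 le_rfl
    have hterm : ∀ k, ∏ i ∈ Finset.Icc 1 (k + 1), f i / (l + f i)
        ≤ (l₀ + f 1) / (l + f 1) * ∏ i ∈ Finset.Icc 1 (k + 1), f i / (l₀ + f i) := by
      intro k
      rw [← Finset.mul_prod_Ioc_eq_prod_Icc (by omega : 1 ≤ k + 1),
        ← Finset.mul_prod_Ioc_eq_prod_Icc (by omega : 1 ≤ k + 1), ← mul_assoc]
      have e : (l₀ + f 1) / (l + f 1) * (f 1 / (l₀ + f 1)) = f 1 / (l + f 1) := by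
        field_simp
      rw [e]
      gcongr with i hi
      · intro i hi
        have := hp i (by have := (Finset.mem_Ioc.1 hi).1; omega)
        positivity
      · exact (hp i (by have := (Finset.mem_Ioc.1 hi).1; omega)).le
      · have := hp i (by have := (Finset.mem_Ioc.1 hi).1; omega)
        positivity
    calc R l ≤ ∑' k, (l₀ + f 1) / (l + f 1) * ∏ i ∈ Finset.Icc 1 (k + 1), f i / (l₀ + f i) :=
          (hsum l hl).tsum_le_tsum hterm (hs.mul_left _)
      _ = _ := tsum_mul_left
  have hR0 : 0 ≤ R l₀ := tsum_nonneg fun k => rhoTerm_nonneg hp hpos _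
  -- Chosen so that `hbound` gives a value at most 1.
  set l₂ := l₁ + (l₀ + f 1) * R l₀ with hl₂
  have hf1 := hp 1 le_rfl
  have h12 : l₁ ≤ l₂ := by rw [hl₂]; nlinarith [mul_nonneg (add_pos hpos hf1).le hR0]
  have hR2 : R l₂ ≤ 1 := by
    refine (hbound l₂ (hlt.le.trans h12)).trans ?_
    rw [div_mul_eq_mul_div, div_le_one (by linarith)]
    linarith
  obtain ⟨l, hl, h⟩ := intermediate_value_Icc' h12
    (hcont.mono fun x hx => hlt.le.trans hx.1) ⟨hR2, hR1.le⟩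
  have hl0 : l₀ ≤ l := hlt.le.trans hl.1
  refine ⟨l, by linarith, (rhoHat_eq_one_iff hp (by linarith)).2 ?_⟩
  exact h ▸ (hsum l hl0).hasSum

theorem existsUnique_rhoHat_eq_one (hf : AttachAssumption f) :
    ∃! l : ℝ, 0 < l ∧ rhoHat f l = 1 := by
  obtain ⟨l, hl, h⟩ := exists_rhoHat_eq_one hf
  refine ⟨l, ⟨hl, h⟩, fun l' ⟨hl', h'⟩ => ?_⟩
  exact hasSum_rhoTerm_injective hf.pos hl' hl ((rhoHat_eq_one_iff hf.pos hl').1 h')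
    ((rhoHat_eq_one_iff hf.pos hl).1 h)

/-- The terms telescope as `T k - T (k + 1)` with `T 0 = 1`, so the sum is `1 - lim T`, and it
remains to see that `T` tends to 0. -/
theorem hasSum_rhoTerm_affine {α : ℝ} (hα : 0 < 1 + α) (hf : ∀ k : ℕ, 1 ≤ k → f k = k + α) :
    HasSum (fun k => ∏ i ∈ Finset.Icc 1 (k + 1), f i / (2 + α + f i)) 1 := by
  have hp : ∀ k, 1 ≤ k → 0 < f k := fun k hk => by
    have : (1 : ℝ) ≤ k := by exact_mod_cast hk
    rw [hf k hk]; linarith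
  have hl : 0 < 2 + α := by linarith
  let T : ℕ → ℝ := fun k => (∏ i ∈ Finset.Icc 1 k, f i / (2 + α + f i)) * ((k + 1 + α) / (1 + α))
  have hk0 : ∀ k : ℕ, 0 < (k : ℝ) + 1 + α := fun k => by
    have : (0 : ℝ) ≤ k := by positivity
    linarith
  have hT0 : ∀ k, 0 ≤ T k := fun k =>
    mul_nonneg (rhoTerm_nonneg hp hl k) (div_nonneg (hk0 k).le hα.le)
  have hterm : ∀ k, ∏ i ∈ Finset.Icc 1 (k + 1), f i / (2 + α + f i) = T k - T (k + 1) := by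
    intro k
    have h1 := hk0 k
    have h2 : 2 + α + ((k : ℝ) + 1 + α) ≠ 0 := by positivity
    simp only [T]
    rw [Finset.prod_Icc_succ_top (by omega), hf (k + 1) (by omega)]
    push_cast
    field_simp
    ring
  have hTstep : ∀ k : ℕ, T k - T (k + 1) = T k * ((1 + α) / (2 + α + (k + 1 + α))) := by
    intro k
    have h1 := hk0 k
    have h2 : 2 + α + ((k : ℝ) + 1 + α) ≠ 0 := by positivity
    rw [← hterm k]
    simp only [T]
    rw [Finset.prod_Icc_succ_top (by omega), hf (k + 1) (by omega)]
    push_cast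
    field_simp
  have hanti : Antitone T := antitone_nat_of_succ_le fun k => by
    have := rhoTerm_nonneg hp hl (k + 1)
    rw [hterm] at this
    linarith
  obtain ⟨t, ht⟩ : ∃ t, Tendsto T atTop (𝓝 t) :=
    ⟨_, tendsto_atTop_ciInf hanti ⟨0, by rintro _ ⟨k, rfl⟩; exact hT0 k⟩⟩
  have htT : ∀ k, t ≤ T k := fun k => hanti.le_of_tendsto ht k
  have hpart : ∀ K, ∑ k ∈ Finset.range K, ∏ i ∈ Finset.Icc 1 (k + 1), f i / (2 + α + f i)
      = 1 - T K := by
    intro K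
    rw [Finset.sum_congr rfl fun k _ => hterm k, Finset.sum_range_sub']
    simp [T, hα.ne']
  have hsum : HasSum (fun k => ∏ i ∈ Finset.Icc 1 (k + 1), f i / (2 + α + f i)) (1 - t) := by
    rw [hasSum_iff_tendsto_nat_of_nonneg fun k => rhoTerm_nonneg hp hl (k + 1)]
    simp_rw [hpart]
    exact ht.const_sub 1
  -- A positive limit would bound the terms below by a multiple of the harmonic series, although
  -- they are summable.
  have ht0 : t = 0 := by
    by_contra hne
    have htpos : 0 < t := lt_of_le_of_ne (ge_of_tendsto' ht hT0) (Ne.symm hne)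
    have hle : ∀ k : ℕ, t * (1 + α) / (3 + 2 * α + 1) * (1 / ((k : ℝ) + 1))
        ≤ ∏ i ∈ Finset.Icc 1 (k + 1), f i / (2 + α + f i) := by
      intro k
      rw [hterm, hTstep]
      have hk : (0 : ℝ) ≤ k := by positivity
      have h3 : 0 < 3 + 2 * α + 1 := by linarith
      calc t * (1 + α) / (3 + 2 * α + 1) * (1 / ((k : ℝ) + 1))
          = t * ((1 + α) / ((3 + 2 * α + 1) * (k + 1))) := by field_simp
        _ ≤ T k * ((1 + α) / (2 + α + (k + 1 + α))) := by
            have := hk0 k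
            gcongr
            · exact hT0 k
            · exact htT k
            · nlinarith [mul_nonneg hk hα.le]
    have h1 := hsum.summable.of_nonneg_of_le (fun k => by
      have h3 : 0 < 3 + 2 * α + 1 := by linarith
      positivity) hle
    have h3 : t * (1 + α) / (3 + 2 * α + 1) ≠ 0 := by
      have h3 : 0 < 3 + 2 * α + 1 := by linarith
      positivity
    rw [summable_mul_left_iff h3] at h1
    exact Real.not_summable_one_div_natCast ((summable_nat_add_iff 1).1 (by simpa using h1))
  simpa [ht0] using hsum

end RhoHat

/-! ### The deterministic fluid limit -/

/-- The drift numerators: the total weight for `k = 0`, and `f k` times the number of vertices of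
degree `k` for `k ≥ 1`. -/
noncomputable def flux (f : ℕ → ℝ) (N : ℕ → ℕ → ℝ) (Ψ : ℕ → ℝ) : ℕ → ℕ → ℝ
  | 0, n => Ψ n
  | k + 1, n => f (k + 1) * (N k n - N (k + 1) n)

/-- Look back to the last time `W` was nonpositive (or to `n₀`): the step out of there costs at most
`B`, and every later step costs at most `η` plus an increment of `E`, whose total is `o(n)`. -/
theorem eventually_le_of_increment_le {W E : ℕ → ℝ} {B η : ℝ} {n₀ : ℕ} (hη : 0 ≤ η)
    (hB : ∀ n, |W (n + 1) - W n| ≤ B) (hE : E =o[atTop] fun n : ℕ => (n : ℝ))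
    (hW : ∀ n, n₀ ≤ n → 0 < W n → W (n + 1) - W n ≤ η + (E (n + 1) - E n)) {ε : ℝ} (hε : 0 < ε) :
    ∀ᶠ n : ℕ in atTop, W n ≤ (η + ε) * n := by
  have hB0 : 0 ≤ B := (abs_nonneg _).trans (hB 0)
  have key : ∀ n, n₀ ≤ n → ∃ m, n₀ ≤ m ∧ m ≤ n ∧
      W n ≤ B + |W n₀| + η * ((n : ℝ) - m) + (E n - E m) := by
    intro n hn
    induction n, hn using Nat.le_induction with
    | base => exact ⟨n₀, le_rfl, le_rfl, by have := le_abs_self (W n₀); simp; linarith⟩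
    | succ n hn ih =>
      obtain ⟨m, hm, hmn, h⟩ := ih
      rcases lt_or_ge 0 (W n) with h0 | h0
      · refine ⟨m, hm, by omega, ?_⟩
        have := hW n hn h0
        push_cast
        linarith
      · refine ⟨n + 1, by omega, le_rfl, ?_⟩
        have := (abs_le.1 (hB n)).2
        have := abs_nonneg (W n₀)
        simp
        linarith
  obtain ⟨n₁, hn₁⟩ := eventually_atTop.1 ((Asymptotics.isLittleO_iff.1 hE) (c := ε / 4) (by positivity))
  -- The restart time `m` may be small, so the bound on `E` is needed at all times; `M` absorbs the
  -- finitely many exceptions.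
  obtain ⟨M, hM0, hM⟩ : ∃ M : ℝ, 0 ≤ M ∧ ∀ m : ℕ, |E m| ≤ ε / 4 * m + M := by
    refine ⟨∑ i ∈ Finset.range n₁, |E i|, Finset.sum_nonneg fun _ _ => abs_nonneg _, fun m => ?_⟩
    rcases lt_or_ge m n₁ with h | h
    · have := Finset.single_le_sum (f := fun i => |E i|) (fun i _ => abs_nonneg _)
        (Finset.mem_range.2 h)
      have h2 : 0 ≤ ε / 4 * m := by positivity
      linarith
    · have := hn₁ m h
      simp only [Real.norm_eq_abs, Nat.abs_cast] at this
      have h2 : 0 ≤ ∑ i ∈ Finset.range n₁, |E i| := Finset.sum_nonneg fun _ _ => abs_nonneg _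
      linarith
  have hlarge : ∀ᶠ n : ℕ in atTop, (B + |W n₀| + 2 * M) / (ε / 2) ≤ n :=
    tendsto_natCast_atTop_atTop.eventually_ge_atTop _
  filter_upwards [hlarge, eventually_ge_atTop n₀] with n hn hnn
  obtain ⟨m, hm, hmn, h⟩ := key n hnn
  rw [div_le_iff₀ (by positivity)] at hn
  have h1 := (abs_le.1 (hM n)).2
  have h2 := (abs_le.1 (hM m)).1
  have h3 : (m : ℝ) ≤ n := by exact_mod_cast hmn
  have h4 : (0 : ℝ) ≤ m := by positivity
  have h5 : η * ((n : ℝ) - m) ≤ η * n := by gcongr; linarith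
  have h6 : ε / 4 * m ≤ ε / 4 * n := by gcongr
  linarith

/-- The data of an asymptotically deterministic evolution of the numbers `N k n` of vertices of
degree at least `k + 1` at time `n`. -/
structure FluidData (f : ℕ → ℝ) (N : ℕ → ℕ → ℝ) (Ψ : ℕ → ℝ) (c C : ℝ) : Prop where
  f_pos : ∀ k, 1 ≤ k → 0 < f k
  c_pos : 0 < c
  zero : ∀ n, N 0 n = n
  step : ∀ k n, |N k (n + 1) - N k n| ≤ 2
  lower : ∀ n, c * n ≤ Ψ n
  upper : ∀ n, Ψ n ≤ C * n
  tail : ∀ ε > 0, ∃ K₀, ∀ K, K₀ ≤ K → ∀ᶠ n : ℕ in atTop,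
    |Ψ n - ∑ k ∈ Finset.range K, flux f N Ψ (k + 1) n| ≤ ε * n
  drift : ∀ k, (fun n => N (k + 1) n - ∑ j ∈ Finset.range n, flux f N Ψ (k + 1) j / Ψ j)
    =o[atTop] fun n : ℕ => (n : ℝ)

namespace FluidData

variable {f : ℕ → ℝ} {N : ℕ → ℕ → ℝ} {Ψ : ℕ → ℝ} {c C : ℝ}

theorem drift' (h : FluidData f N Ψ c C) (k : ℕ) :
    (fun n => N k n - ∑ j ∈ Finset.range n, flux f N Ψ k j / Ψ j)
      =o[atTop] fun n : ℕ => (n : ℝ) := by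
  cases k with
  | succ k => exact h.drift k
  | zero =>
    have hb : (fun n => N 0 n - ∑ j ∈ Finset.range n, flux f N Ψ 0 j / Ψ j)
        =O[atTop] fun _ : ℕ => (1 : ℝ) := by
      refine Asymptotics.IsBigO.of_bound 1 ?_
      filter_upwards [eventually_ge_atTop 1] with n hn
      obtain ⟨n, rfl⟩ := Nat.exists_eq_add_of_le' hn
      have h1 : ∀ j ∈ Finset.range n, flux f N Ψ 0 (j + 1) / Ψ (j + 1) = 1 := fun j _ => by
        refine div_self (ne_of_gt (lt_of_lt_of_le ?_ (h.lower (j + 1))))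
        have := h.c_pos
        push_cast
        positivity
      rw [h.zero, Finset.sum_range_succ', Finset.sum_congr rfl h1]
      simp only [flux, Finset.sum_const, Finset.card_range, nsmul_eq_mul, norm_one, mul_one,
        Real.norm_eq_abs]
      -- At time 0 the quotient `Ψ 0 / Ψ 0` is 0 if `Ψ 0 = 0`, and 1 otherwise; the error is at most
      -- 1 in both cases.
      push_cast
      rcases eq_or_ne (Ψ 0) 0 with h0 | h0
      · simp [h0]
      · simp [h0]
    exact hb.trans_isLittleO (Asymptotics.isLittleO_const_left.2
      (Or.inr (tendsto_norm_atTop_atTop.comp tendsto_natCast_atTop_atTop)))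

/-- If `s * (Ψ n - L * n)` is asymptotically at most `o(n)`, then so is
`s * (flux k n - L * N k n)` for every `k`. -/
theorem flux_bound (h : FluidData f N Ψ c C) {s L : ℝ} (hL : 0 < L)
    (h0 : ∀ ε > 0, ∀ᶠ n : ℕ in atTop, s * (Ψ n - L * n) ≤ ε * n) (k : ℕ) :
    ∀ ε > 0, ∀ᶠ n : ℕ in atTop, s * (flux f N Ψ k n - L * N k n) ≤ ε * n := by
  induction k with
  | zero => simpa only [flux, h.zero] using h0
  | succ k ih =>
    intro ε hε
    have hf := h.f_pos (k + 1) (by omega)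
    have hc := h.c_pos
    set F := f (k + 1) with hF
    set a := (L + F) / F with ha
    have haF : a * F = L + F := by rw [ha]; field_simp
    let e : ℕ → ℕ → ℝ := fun k n => N k n - ∑ j ∈ Finset.range n, flux f N Ψ k j / Ψ j
    have he : ∀ k n, N k (n + 1) - N k n = flux f N Ψ k n / Ψ n + (e k (n + 1) - e k n) := by
      intro k n
      simp only [e, Finset.sum_range_succ]
      ring
    -- `a` is chosen so that `F * W` is exactly the quantity to be bounded at level `k + 1`.
    set W : ℕ → ℝ := fun n => s * (N k n - a * N (k + 1) n) with hW
    have hFW : ∀ n, F * W n = s * (flux f N Ψ (k + 1) n - L * N (k + 1) n) := by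
      intro n
      simp only [hW, flux, ← hF]
      linear_combination (-s * N (k + 1) n) * haF
    have hη : (0 : ℝ) ≤ ε / (2 * F) := by positivity
    have hstep : ∀ n, |W (n + 1) - W n| ≤ |s| * (2 + 2 * |a|) := by
      intro n
      have : W (n + 1) - W n
          = s * ((N k (n + 1) - N k n) + -a * (N (k + 1) (n + 1) - N (k + 1) n)) := by
        simp only [hW]; ring
      rw [this, abs_mul]
      gcongr
      refine (abs_add_le _ _).trans ?_
      rw [abs_mul, abs_neg]
      have h1 := h.step k n
      have h2 := mul_le_mul_of_nonneg_left (h.step (k + 1) n) (abs_nonneg a)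
      linarith
    have hE : (fun n => s * (e k n - a * e (k + 1) n)) =o[atTop] fun n : ℕ => (n : ℝ) :=
      ((h.drift' k).sub ((h.drift' (k + 1)).const_mul_left a)).const_mul_left s
    obtain ⟨n₀, hn₀⟩ := eventually_atTop.1 (ih (ε / (2 * F) * c) (by positivity))
    have hinc : ∀ n, max n₀ 1 ≤ n → 0 < W n → W (n + 1) - W n ≤
        ε / (2 * F) + (s * (e k (n + 1) - a * e (k + 1) (n + 1)) -
          s * (e k n - a * e (k + 1) n)) := by
      intro n hn hpos
      have hn1 : (1 : ℝ) ≤ n := by exact_mod_cast (le_max_right _ _).trans hn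
      have hΨ : 0 < Ψ n := lt_of_lt_of_le (by positivity) (h.lower n)
      have h1 := hn₀ n ((le_max_left _ _).trans hn)
      have h2 : W (n + 1) - W n = s * (flux f N Ψ k n - a * flux f N Ψ (k + 1) n) / Ψ n +
          (s * (e k (n + 1) - a * e (k + 1) (n + 1)) - s * (e k n - a * e (k + 1) n)) := by
        have e1 := he k n
        have e2 := he (k + 1) n
        have : W (n + 1) - W n
          = s * ((N k (n + 1) - N k n) - a * (N (k + 1) (n + 1) - N (k + 1) n)) := by
          simp only [hW]; ring
        rw [this, e1, e2]
        ring
      have h3 : s * (flux f N Ψ k n - a * flux f N Ψ (k + 1) n) ≤ ε / (2 * F) * Ψ n := by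
        -- The drift of `W` is the level `k` quantity minus `F * W`, over `Ψ`: it pulls `W` back
        -- whenever `W > 0`.
        have h4 : s * (flux f N Ψ k n - a * flux f N Ψ (k + 1) n)
            = s * (flux f N Ψ k n - L * N k n) - F * W n := by
          simp only [hW, flux, ← hF]
          linear_combination (-s * N k n) * haF
        have h5 : ε / (2 * F) * c * n ≤ ε / (2 * F) * Ψ n := by
          rw [mul_assoc]; gcongr; exact h.lower n
        have h6 : 0 < F * W n := by positivity
        linarith
      rw [h2]
      have := (div_le_iff₀ hΨ).2 h3
      linarith
    filter_upwards [eventually_le_of_increment_le hη hstep hE hinc (ε := ε / (2 * F))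
      (by positivity)] with n hn
    rw [← hFW]
    calc F * W n ≤ F * ((ε / (2 * F) + ε / (2 * F)) * n) := by gcongr
      _ = ε * n := by field_simp; ring

/-- The growth rates `flux (k + 1) / Ψ` add up over `k < K` to nearly 1 by `tail`, which is the
growth rate of `N 0 n = n`. For trees this reflects that the excesses `deg - 1` sum to `n - 2`. -/
theorem sum_N_bound (h : FluidData f N Ψ c C) {ε : ℝ} (hε : 0 < ε) : ∃ K₀, ∀ K, K₀ ≤ K →
    ∀ᶠ n : ℕ in atTop, |(n : ℝ) - ∑ k ∈ Finset.range K, N (k + 1) n| ≤ ε * n := by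
  have hc := h.c_pos
  obtain ⟨K₀, hK₀⟩ := h.tail (ε / 4 * c) (by positivity)
  refine ⟨K₀, fun K hK => ?_⟩
  let e : ℕ → ℕ → ℝ := fun k n => N k n - ∑ j ∈ Finset.range n, flux f N Ψ k j / Ψ j
  have hE : (fun n => e 0 n - ∑ k ∈ Finset.range K, e (k + 1) n) =o[atTop] fun n : ℕ => (n : ℝ) :=
    (h.drift' 0).sub (Asymptotics.IsLittleO.fun_sum fun k _ => h.drift' (k + 1))
  let T : ℕ → ℝ := fun j => (Ψ j - ∑ k ∈ Finset.range K, flux f N Ψ (k + 1) j) / Ψ j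
  have hT : ∀ᶠ j in atTop, |T j| ≤ ε / 4 := by
    filter_upwards [hK₀ K hK, eventually_ge_atTop 1] with j hj hj1
    have hj1' : (1 : ℝ) ≤ j := by exact_mod_cast hj1
    have hΨ : 0 < Ψ j := lt_of_lt_of_le (by positivity) (h.lower j)
    simp only [T]
    rw [abs_div, abs_of_pos hΨ, div_le_iff₀ hΨ]
    refine hj.trans ?_
    rw [mul_assoc]
    gcongr
    exact h.lower j
  obtain ⟨n₁, hn₁⟩ := eventually_atTop.1 hT
  have hid : ∀ n : ℕ, (n : ℝ) - ∑ k ∈ Finset.range K, N (k + 1) n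
      = (e 0 n - ∑ k ∈ Finset.range K, e (k + 1) n) + ∑ j ∈ Finset.range n, T j := by
    intro n
    have : ∑ j ∈ Finset.range n, T j = ∑ j ∈ Finset.range n, flux f N Ψ 0 j / Ψ j -
        ∑ k ∈ Finset.range K, ∑ j ∈ Finset.range n, flux f N Ψ (k + 1) j / Ψ j := by
      rw [Finset.sum_comm, ← Finset.sum_sub_distrib]
      refine Finset.sum_congr rfl fun j _ => ?_
      simp only [T, flux, sub_div, Finset.sum_div]
    rw [this]
    simp only [e, Finset.sum_sub_distrib, h.zero]
    ring
  have hTs : ∀ n : ℕ, |∑ j ∈ Finset.range n, T j| ≤ ∑ j ∈ Finset.range n₁, |T j| + ε / 4 * n := by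
    intro n
    refine (Finset.abs_sum_le_sum_abs _ _).trans ?_
    calc ∑ j ∈ Finset.range n, |T j|
        ≤ ∑ j ∈ Finset.range n, ((if j < n₁ then |T j| else 0) + ε / 4) := by
          refine Finset.sum_le_sum fun j _ => ?_
          split_ifs with hj
          · linarith
          · have := hn₁ j (by omega); linarith
      _ = ∑ j ∈ (Finset.range n).filter (· < n₁), |T j| + ε / 4 * n := by
          rw [Finset.sum_add_distrib, Finset.sum_filter]; simp [mul_comm]
      _ ≤ _ := by
          gcongr
          intro j hj
          simp only [Finset.mem_filter] at hj
          exact Finset.mem_range.2 hj.2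
  have hlarge : ∀ᶠ n : ℕ in atTop, (∑ j ∈ Finset.range n₁, |T j|) / (ε / 4) ≤ n :=
    tendsto_natCast_atTop_atTop.eventually_ge_atTop _
  filter_upwards [hlarge, (Asymptotics.isLittleO_iff.1 hE) (c := ε / 4) (by positivity)]
    with n h1 h2
  rw [div_le_iff₀ (by positivity)] at h1
  simp only [Real.norm_eq_abs, Nat.abs_cast] at h2
  rw [hid]
  refine (abs_add_le _ _).trans ?_
  have := hTs n
  nlinarith

/-- One-sided bounds whose sum is asymptotically zero must be equalities. The sign `s` serves the
upper limit (`1`) and the lower limit (`-1`) at once. -/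
theorem hasSum_of_mapClusterPt (h : FluidData f N Ψ c C) {s L : ℝ} (hs : s = 1 ∨ s = -1)
    (hL : 0 < L) (h0 : ∀ ε > 0, ∀ᶠ n : ℕ in atTop, s * (Ψ n - L * n) ≤ ε * n)
    (hcl : MapClusterPt L atTop fun n : ℕ => Ψ n / n) :
    HasSum (fun k => ∏ i ∈ Finset.Icc 1 (k + 1), f i / (L + f i)) 1 := by
  -- This filter plays the role of a subsequence along which `Ψ n / n → L`.
  set l : Filter ℕ := atTop ⊓ comap (fun n : ℕ => Ψ n / n) (𝓝 L) with hl
  have hne : l.NeBot := by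
    rw [hl, ← Filter.map_neBot_iff (fun n : ℕ => Ψ n / n), Filter.push_pull, inf_comm]
    exact hcl
  have hla : l ≤ atTop := inf_le_left
  have hlim : Tendsto (fun n : ℕ => Ψ n / n) l (𝓝 L) := tendsto_comap.mono_left inf_le_right
  have hsabs : |s| = 1 := by rcases hs with rfl | rfl <;> norm_num
  have hpos : ∀ᶠ n : ℕ in l, (1 : ℝ) ≤ n :=
    hla ((eventually_ge_atTop 1).mono fun n hn => by exact_mod_cast hn)
  let w : ℕ → ℕ → ℝ := fun k n => s * (flux f N Ψ k n - L * N k n)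
  have hup : ∀ k, ∀ ε > 0, ∀ᶠ n : ℕ in l, w k n ≤ ε * n := fun k ε hε =>
    hla (h.flux_bound hL h0 k ε hε)
  have hw0 : ∀ ε > 0, ∀ᶠ n : ℕ in l, |w 0 n| ≤ ε * n := by
    intro ε hε
    filter_upwards [hpos, hlim.eventually (Metric.closedBall_mem_nhds L hε)] with n hn h1
    have hn0 : (0 : ℝ) < n := by linarith
    have e : w 0 n = s * ((Ψ n / n - L) * n) := by
      simp only [w, flux, h.zero]
      field_simp
    rw [e, abs_mul, hsabs, one_mul, abs_mul, Nat.abs_cast]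
    gcongr
    exact h1
  -- The truncated sum of the `w (i + 1)` is `w 0` up to the two tail errors; bounding all other
  -- summands above bounds the remaining one below. The quarters of `ε` are these four errors.
  have hlow : ∀ k, ∀ ε > 0, ∀ᶠ n : ℕ in l, -(ε * n) ≤ w (k + 1) n := by
    intro k ε hε
    obtain ⟨K₁, hK₁⟩ := h.tail (ε / 4) (by positivity)
    obtain ⟨K₂, hK₂⟩ := h.sum_N_bound (ε := ε / (4 * L)) (by positivity)
    set K := max (k + 1) (max K₁ K₂) with hK
    have h1 := hla (hK₁ K (by omega))
    have h2 := hla (hK₂ K (by omega))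
    have h3 : ∀ᶠ n in l, ∀ i ∈ Finset.range K, w (i + 1) n ≤ ε / (4 * K) * n :=
      (Finset.eventually_all _).2 fun i _ => hup (i + 1) _ (by positivity)
    filter_upwards [hpos, h1, h2, h3, hw0 (ε / 4) (by positivity)] with n hn h1 h2 h3 h4
    have hk : k ∈ Finset.range K := Finset.mem_range.2 (by omega)
    have hsum : ∑ i ∈ Finset.range K, w (i + 1) n = w 0 n
        - s * (Ψ n - ∑ k ∈ Finset.range K, flux f N Ψ (k + 1) n)
        + L * (s * ((n : ℝ) - ∑ k ∈ Finset.range K, N (k + 1) n)) := by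
      simp only [w, ← Finset.mul_sum, Finset.sum_sub_distrib, h.zero, flux]
      ring
    have h5 : ∑ i ∈ (Finset.range K).erase k, w (i + 1) n ≤ ε / 4 * n := by
      calc _ ≤ ∑ i ∈ (Finset.range K).erase k, ε / (4 * K) * n :=
            Finset.sum_le_sum fun i hi => h3 i (Finset.mem_of_mem_erase hi)
        _ ≤ ∑ i ∈ Finset.range K, ε / (4 * K) * n :=
            Finset.sum_le_sum_of_subset_of_nonneg (Finset.erase_subset _ _)
              fun _ _ _ => by positivity
        _ = ε / 4 * n := by
            have : (K : ℝ) ≠ 0 := by norm_cast; omega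
            simp; field_simp
    have h6 := Finset.add_sum_erase (Finset.range K) (fun i => w (i + 1) n) hk
    have h7 : |s * (Ψ n - ∑ k ∈ Finset.range K, flux f N Ψ (k + 1) n)| ≤ ε / 4 * n := by
      rw [abs_mul, hsabs, one_mul]; exact h1
    have h8 : |L * (s * ((n : ℝ) - ∑ k ∈ Finset.range K, N (k + 1) n))| ≤ ε / 4 * n := by
      rw [abs_mul, abs_mul, hsabs, one_mul, abs_of_pos hL]
      calc _ ≤ L * (ε / (4 * L) * n) := by gcongr
        _ = ε / 4 * n := by field_simp
    have := abs_le.1 h7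
    have := abs_le.1 h8
    have := abs_le.1 h4
    linarith
  have hflux : ∀ k, Tendsto (fun n : ℕ => flux f N Ψ (k + 1) n / n - L * (N (k + 1) n / n)) l
      (𝓝 0) := by
    intro k
    rw [Metric.tendsto_nhds]
    intro ε hε
    filter_upwards [hpos, hup (k + 1) (ε / 2) (by positivity), hlow k (ε / 2) (by positivity)]
      with n hn h1 h2
    have hw : w (k + 1) n / n = s * (flux f N Ψ (k + 1) n / n - L * (N (k + 1) n / n)) := by
      simp only [w]; ring
    have : |w (k + 1) n / n| < ε := by
      rw [abs_div, Nat.abs_cast, div_lt_iff₀ (by linarith)]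
      have := abs_le.2 ⟨h2, h1⟩
      nlinarith
    rw [hw, abs_mul, hsabs, one_mul] at this
    simpa [Real.dist_eq] using this
  -- Equality in the limit reads `f (k + 1) (x_k - x_{k+1}) = L x_{k+1}`, which determines each
  -- proportion from the previous one.
  have hN : ∀ k, Tendsto (fun n : ℕ => N k n / n) l
      (𝓝 (∏ i ∈ Finset.Icc 1 k, f i / (L + f i))) := by
    intro k
    induction k with
    | zero =>
      refine Tendsto.congr' (f₁ := fun _ => (1 : ℝ)) ?_ (by simp)
      filter_upwards [hpos] with n hn
      rw [h.zero, div_self (by linarith)]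
    | succ k ih =>
      have hf := h.f_pos (k + 1) (by omega)
      rw [Finset.prod_Icc_succ_top (by omega)]
      have h1 := ((ih.const_mul (f (k + 1))).sub (hflux k)).div_const (L + f (k + 1))
      rw [sub_zero] at h1
      have e : f (k + 1) * (∏ i ∈ Finset.Icc 1 k, f i / (L + f i)) / (L + f (k + 1))
        = (∏ i ∈ Finset.Icc 1 k, f i / (L + f i)) * (f (k + 1) / (L + f (k + 1))) := by ring
      rw [e] at h1
      refine h1.congr fun n => ?_
      simp only [flux]
      have : L + f (k + 1) ≠ 0 := by positivity
      field_simp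
      ring
  have hx0 : ∀ k, 0 ≤ ∏ i ∈ Finset.Icc 1 (k + 1), f i / (L + f i) := fun k =>
    Finset.prod_nonneg fun i hi => by
      have := h.f_pos i (Finset.mem_Icc.1 hi).1
      positivity
  rw [hasSum_iff_tendsto_nat_of_nonneg hx0, Metric.tendsto_atTop]
  intro ε hε
  obtain ⟨K₀, hK₀⟩ := h.sum_N_bound (ε := ε / 2) (by positivity)
  refine ⟨K₀, fun K hK => ?_⟩
  have h1 : Tendsto (fun n : ℕ => ∑ k ∈ Finset.range K, N (k + 1) n / n) l
      (𝓝 (∑ k ∈ Finset.range K, ∏ i ∈ Finset.Icc 1 (k + 1), f i / (L + f i))) :=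
    tendsto_finsetSum _ fun k _ => hN (k + 1)
  have h2 : |(∑ k ∈ Finset.range K, ∏ i ∈ Finset.Icc 1 (k + 1), f i / (L + f i)) - 1| ≤ ε / 2 := by
    refine le_of_tendsto ((h1.sub_const 1).abs) ?_
    filter_upwards [hpos, hla (hK₀ K hK)] with n hn h3
    have : ∑ k ∈ Finset.range K, N (k + 1) n / n - 1
        = -(((n : ℝ) - ∑ k ∈ Finset.range K, N (k + 1) n) / n) := by
      rw [← Finset.sum_div]
      have : (n : ℝ) ≠ 0 := by linarith
      field_simp
      ring
    rw [this, abs_neg, abs_div, Nat.abs_cast, div_le_iff₀ (by linarith)]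
    exact h3
  rw [Real.dist_eq]
  linarith

/-- In the fluid limit the total weight per vertex converges to the only possible Malthusian
rate. -/
theorem tendsto_div (h : FluidData f N Ψ c C) {lam : ℝ}
    (huniq : ∀ L, 0 < L → HasSum (fun k => ∏ i ∈ Finset.Icc 1 (k + 1), f i / (L + f i)) 1 →
      L = lam) :
    Tendsto (fun n : ℕ => Ψ n / n) atTop (𝓝 lam) := by
  set u : ℕ → ℝ := fun n => Ψ n / n with hu
  have hlo : ∀ᶠ n in atTop, c ≤ u n := by
    filter_upwards [eventually_ge_atTop 1] with n hn
    have : (1 : ℝ) ≤ n := by exact_mod_cast hn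
    rw [hu, le_div_iff₀ (by linarith)]
    exact h.lower n
  have hhi : ∀ᶠ n in atTop, u n ≤ C := by
    filter_upwards [eventually_ge_atTop 1] with n hn
    have : (1 : ℝ) ≤ n := by exact_mod_cast hn
    rw [hu, div_le_iff₀ (by linarith)]
    exact h.upper n
  have hbu : IsBoundedUnder (· ≤ ·) atTop u := ⟨C, by simpa using hhi⟩
  have hbl : IsBoundedUnder (· ≥ ·) atTop u := ⟨c, by simpa using hlo⟩
  have hc := h.c_pos
  have hsup : limsup u atTop = lam := by
    have hL : 0 < limsup u atTop :=
      hc.trans_le ((le_liminf_of_le hbu.isCoboundedUnder_ge hlo).trans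
        (liminf_le_limsup hbu hbl))
    refine huniq _ hL (h.hasSum_of_mapClusterPt (Or.inl rfl) hL (fun ε hε => ?_) ?_)
    · filter_upwards [eventually_lt_of_limsup_lt (lt_add_of_pos_right _ hε) hbu,
        eventually_ge_atTop 1] with n hn hn1
      have : (1 : ℝ) ≤ n := by exact_mod_cast hn1
      rw [hu, div_lt_iff₀ (by linarith)] at hn
      linarith
    · rw [mapClusterPt_iff_frequently]
      intro s hs
      obtain ⟨ε, hε, hs⟩ := Metric.mem_nhds_iff.1 hs
      refine ((frequently_lt_of_lt_limsup hbl.isCoboundedUnder_le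
        (sub_lt_self _ hε)).and_eventually
        (eventually_lt_of_limsup_lt (lt_add_of_pos_right _ hε) hbu)).mono fun n hn => hs ?_
      rw [Real.ball_eq_Ioo]
      exact hn
  have hinf : liminf u atTop = lam := by
    have hL : 0 < liminf u atTop :=
      hc.trans_le (le_liminf_of_le hbu.isCoboundedUnder_ge hlo)
    refine huniq _ hL (h.hasSum_of_mapClusterPt (Or.inr rfl) hL (fun ε hε => ?_) ?_)
    · filter_upwards [eventually_lt_of_lt_liminf (sub_lt_self _ hε) hbl,
        eventually_ge_atTop 1] with n hn hn1
      have : (1 : ℝ) ≤ n := by exact_mod_cast hn1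
      rw [hu, lt_div_iff₀ (by linarith)] at hn
      linarith
    · rw [mapClusterPt_iff_frequently]
      intro s hs
      obtain ⟨ε, hε, hs⟩ := Metric.mem_nhds_iff.1 hs
      refine ((frequently_lt_of_liminf_lt hbu.isCoboundedUnder_ge
        (lt_add_of_pos_right _ hε)).and_eventually
        (eventually_lt_of_lt_liminf (sub_lt_self _ hε) hbl)).mono fun n hn => hs ?_
      rw [Real.ball_eq_Ioo]
      exact hn.symm
  exact tendsto_of_liminf_eq_limsup hinf hsup hbu hbl

end FluidData

/-! ### Degrees in recursive trees -/

/-- Every vertex is attached to an earlier one. -/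
def IsRecursive (p : ℕ → ℕ) : Prop := ∀ n, 1 ≤ n → p (n + 1) ∈ Finset.Icc 1 n

/-- The number of vertices of degree at least `k + 1` at time `n`. -/
def tailCount (p : ℕ → ℕ) (k n : ℕ) : ℕ :=
  ((Finset.Icc 1 n).filter fun i => k + 1 ≤ deg p i n).card

theorem children_succ (p : ℕ → ℕ) (i : ℕ) {n : ℕ} (hn : 1 ≤ n) :
    children p i (n + 1) = children p i n + if p (n + 1) = i then 1 else 0 := by
  unfold children
  rw [← Finset.insert_Icc_right_eq_Icc_add_one (by omega), Finset.filter_insert]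
  split_ifs with h
  · rw [Finset.card_insert_of_notMem (by simp)]
  · rfl

theorem deg_succ (p : ℕ → ℕ) (i : ℕ) {n : ℕ} (hn : 2 ≤ n) :
    deg p i (n + 1) = deg p i n + if p (n + 1) = i then 1 else 0 := by
  unfold deg
  rw [children_succ p i (by omega)]
  split_ifs <;> omega

namespace IsRecursive

variable {p : ℕ → ℕ}

theorem two (hp : IsRecursive p) : p 2 = 1 := by simpa using hp 1 le_rfl

theorem bounds (hp : IsRecursive p) {j : ℕ} (hj : 2 ≤ j) : 1 ≤ p j ∧ p j < j := by
  obtain ⟨j, rfl⟩ := Nat.exists_eq_add_of_le' (by omega : 1 ≤ j)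
  have := Finset.mem_Icc.1 (hp j (by omega))
  omega

theorem deg_self (hp : IsRecursive p) {n : ℕ} (hn : 1 ≤ n) : deg p (n + 1) (n + 1) = 1 := by
  have : children p (n + 1) (n + 1) = 0 := by
    rw [children, Finset.card_eq_zero, Finset.filter_eq_empty_iff]
    intro j hj
    have := Finset.mem_Icc.1 hj
    have := hp.bounds this.1
    omega
  rw [deg, if_neg (by omega), this]

theorem deg_two (hp : IsRecursive p) {i : ℕ} (hi : i ∈ Finset.Icc 1 2) : deg p i 2 = 1 := by
  have h2 := hp.two
  have : i = 1 ∨ i = 2 := by have := Finset.mem_Icc.1 hi; omega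
  rcases this with rfl | rfl
  · simp [deg, children, Finset.filter_singleton, h2]
  · simp [deg, children, Finset.filter_singleton, h2]

theorem deg_one_one (p : ℕ → ℕ) (i : ℕ) : deg p i 1 = 1 := by
  simp [deg, children]

theorem children_mono (p : ℕ → ℕ) (i : ℕ) {m n : ℕ} (h : m ≤ n) :
    children p i m ≤ children p i n :=
  Finset.card_le_card (Finset.filter_subset_filter _ (Finset.Icc_subset_Icc_right h))

theorem deg_mono (hp : IsRecursive p) (i : ℕ) {m n : ℕ} (h : m ≤ n) : deg p i m ≤ deg p i n := by
  have h1 := children_mono p i h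
  unfold deg
  split_ifs with h2 h3 h3
  · exact h1
  · omega
  -- The root before time 2 has conventional degree 1; afterwards the edge to vertex 2 keeps it at
  -- least 1.
  · have hm : children p i m = 0 := by
      rw [children, Finset.Icc_eq_empty (by omega)]; simp
    have h2 : 2 ∈ (Finset.Icc 2 n).filter fun j => p j = i := by
      simp [hp.two, h3.1, h3.2]
    have := Finset.card_pos.2 ⟨2, h2⟩
    unfold children at *
    omega
  · omega

theorem one_le_deg (hp : IsRecursive p) (i n : ℕ) : 1 ≤ deg p i n := by
  rcases Nat.eq_zero_or_pos n with rfl | hn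
  · simp [deg]
  · exact (deg_one_one p i).symm.le.trans (hp.deg_mono i hn)

theorem sum_deg (hp : IsRecursive p) {n : ℕ} (hn : 2 ≤ n) :
    ∑ i ∈ Finset.Icc 1 n, deg p i n + 2 = 2 * n := by
  induction n, hn using Nat.le_induction with
  | base => rw [Finset.sum_congr rfl fun i hi => hp.deg_two hi]; simp
  | succ n hn ih =>
    rw [Finset.sum_Icc_succ_top (by omega), hp.deg_self (by omega),
      Finset.sum_congr rfl fun i _ => deg_succ p i hn, Finset.sum_add_distrib,
      Finset.sum_ite_eq, if_pos (hp n (by omega))]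
    omega

theorem sum_deg_le (hp : IsRecursive p) (n : ℕ) :
    ∑ i ∈ Finset.Icc 1 n, deg p i n ≤ 2 * n := by
  rcases lt_or_ge n 2 with h | h
  · interval_cases n
    · simp
    · simp [deg_one_one]
  · have := hp.sum_deg h; omega

theorem sum_deg_le_real (hp : IsRecursive p) (n : ℕ) :
    ∑ i ∈ Finset.Icc 1 n, (deg p i n : ℝ) ≤ 2 * n := by exact_mod_cast hp.sum_deg_le n

theorem deg_eq_of_not_parent (hp : IsRecursive p) {i m n : ℕ} (hm : 1 ≤ m) (hmn : m ≤ n)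
    (h : ∀ j ∈ Finset.Ioc m n, p j ≠ i) : deg p i n = deg p i m := by
  have hc : children p i n = children p i m := by
    unfold children
    congr 1
    ext j
    simp only [Finset.mem_filter, Finset.mem_Icc]
    constructor
    · rintro ⟨h1, h2⟩
      refine ⟨⟨h1.1, ?_⟩, h2⟩
      by_contra h3
      exact h j (Finset.mem_Ioc.2 ⟨by omega, h1.2⟩) h2
    · rintro ⟨h1, h2⟩
      exact ⟨⟨h1.1, h1.2.trans hmn⟩, h2⟩
  unfold deg
  rw [hc]
  -- The convention for the root changes at time 2 only, and then the root is itself a parent.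
  by_cases h1 : i = 1 ∧ 2 ≤ n
  · have : 2 ≤ m := by
      by_contra h2
      exact h 2 (Finset.mem_Ioc.2 ⟨by omega, h1.2⟩) (hp.two.trans h1.1.symm)
    rw [if_pos h1, if_pos ⟨h1.1, this⟩]
  · rw [if_neg h1, if_neg fun h2 => h1 ⟨h2.1, h2.2.trans hmn⟩]

/-- A vertex whose degree changes is a parent of one of the `n - m` vertices added meanwhile. -/
theorem card_changed_le (hp : IsRecursive p) {m n : ℕ} (hm : 1 ≤ m) (hmn : m ≤ n) :
    ((Finset.Icc 1 m).filter fun i => deg p i n ≠ deg p i m).card ≤ n - m := by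
  have : (Finset.Icc 1 m).filter (fun i => deg p i n ≠ deg p i m) ⊆ (Finset.Ioc m n).image p := by
    intro i hi
    by_contra h
    refine (Finset.mem_filter.1 hi).2 (hp.deg_eq_of_not_parent hm hmn fun j hj hji => h ?_)
    exact Finset.mem_image.2 ⟨j, hj, hji⟩
  calc _ ≤ _ := Finset.card_le_card this
    _ ≤ _ := Finset.card_image_le
    _ = n - m := by simp

theorem tailCount_zero (hp : IsRecursive p) (n : ℕ) : tailCount p 0 n = n := by
  rw [tailCount, Finset.filter_true_of_mem fun i _ => by simpa using hp.one_le_deg i n]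
  simp

theorem tailCount_le (p : ℕ → ℕ) (k n : ℕ) : tailCount p k n ≤ n :=
  (Finset.card_filter_le _ _).trans (by simp)

theorem tailCount_succ (hp : IsRecursive p) (k : ℕ) {n : ℕ} (hn : 2 ≤ n) :
    tailCount p (k + 1) (n + 1)
      = tailCount p (k + 1) n + if deg p (p (n + 1)) n = k + 1 then 1 else 0 := by
  have h1 : ∀ i ∈ Finset.Icc 1 n, (if k + 1 + 1 ≤ deg p i (n + 1) then 1 else 0)
      = (if k + 1 + 1 ≤ deg p i n then 1 else 0)
        + if p (n + 1) = i then (if deg p i n = k + 1 then 1 else 0) else 0 := by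
    intro i _
    rw [deg_succ p i hn]
    split_ifs <;> omega
  unfold tailCount
  rw [Finset.card_filter, Finset.card_filter, Finset.sum_Icc_succ_top (by omega),
    hp.deg_self (by omega), Finset.sum_congr rfl h1, Finset.sum_add_distrib,
    Finset.sum_ite_eq, if_pos (hp n (by omega))]
  simp

theorem tailCount_add_degCount (p : ℕ → ℕ) (k n : ℕ) :
    tailCount p (k + 1) n + degCount p (k + 1) n = tailCount p k n := by
  unfold tailCount degCount
  rw [Finset.card_filter, Finset.card_filter, Finset.card_filter, ← Finset.sum_add_distrib]
  refine Finset.sum_congr rfl fun i _ => ?_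
  split_ifs <;> omega

end IsRecursive

theorem degCount_eq_sum (p : ℕ → ℕ) (k n : ℕ) (a : ℝ) :
    a * degCount p k n = ∑ i ∈ Finset.Icc 1 n, if deg p i n = k then a else 0 := by
  rw [degCount, ← Finset.sum_filter, Finset.sum_const, nsmul_eq_mul, mul_comm]

theorem hasSum_totalWeight (f : ℕ → ℝ) {p : ℕ → ℕ} (hp : IsRecursive p) (n : ℕ) :
    HasSum (fun k : ℕ => f (k + 1) * (degCount p (k + 1) n : ℝ)) (totalWeight f p n) := by
  simp_rw [degCount_eq_sum]
  refine hasSum_sum fun i _ => ?_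
  obtain ⟨d, hd⟩ := Nat.exists_eq_add_of_le' (hp.one_le_deg i n)
  rw [hd]
  convert hasSum_single d fun k hk => ?_ using 1
  · simp
  · rw [if_neg (by omega)]

/-! ### Stability of attachment weights under a delay -/

section Weights

variable {f : ℕ → ℝ} {p : ℕ → ℕ} {c : ℝ}

theorem IsRecursive.le_totalWeight (hp : IsRecursive p) (hf : ∀ k, 1 ≤ k → c ≤ f k) (n : ℕ) :
    c * n ≤ totalWeight f p n := by
  calc c * n = ∑ i ∈ Finset.Icc 1 n, c := by simp [mul_comm]
    _ ≤ _ := Finset.sum_le_sum fun i _ => hf _ (hp.one_le_deg i n)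

theorem IsRecursive.totalWeight_le (hp : IsRecursive p) {C : ℝ}
    (hf : ∀ k : ℕ, 1 ≤ k → f k ≤ C * k) (hC : 0 ≤ C) (n : ℕ) :
    totalWeight f p n ≤ 2 * C * n := by
  calc totalWeight f p n ≤ ∑ i ∈ Finset.Icc 1 n, C * (deg p i n : ℝ) :=
        Finset.sum_le_sum fun i _ => hf _ (hp.one_le_deg i n)
    _ = C * ∑ i ∈ Finset.Icc 1 n, (deg p i n : ℝ) := by rw [Finset.mul_sum]
    _ ≤ C * (2 * n) := by gcongr; exact hp.sum_deg_le_real n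
    _ = _ := by ring

theorem IsSublinear.exists_le (hs : IsSublinear f) {ε : ℝ} (hε : 0 < ε) :
    ∃ K : ℕ, ∀ d, K ≤ d → f d ≤ ε * d := by
  obtain ⟨K, hK⟩ := eventually_atTop.1 (hs.eventually (gt_mem_nhds hε))
  refine ⟨max K 1, fun d hd => ?_⟩
  have hd1 : (1 : ℝ) ≤ d := by exact_mod_cast (le_max_right _ _).trans hd
  exact ((div_lt_iff₀ (by linarith)).1 (hK d ((le_max_left _ _).trans hd))).le

theorem IsSublinear.exists_le_add (hs : IsSublinear f) {ε : ℝ} (hε : 0 < ε) :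
    ∃ A : ℝ, 0 ≤ A ∧ ∀ d, f d ≤ A + ε * d := by
  obtain ⟨K, hK⟩ := hs.exists_le hε
  refine ⟨∑ d ∈ Finset.range K, |f d|, Finset.sum_nonneg fun _ _ => abs_nonneg _, fun d => ?_⟩
  have h0 : 0 ≤ ∑ d ∈ Finset.range K, |f d| := Finset.sum_nonneg fun _ _ => abs_nonneg _
  rcases lt_or_ge d K with h | h
  · have := Finset.single_le_sum (f := fun d => |f d|) (fun i _ => abs_nonneg _)
      (Finset.mem_range.2 h)
    have := le_abs_self (f d)
    have : 0 ≤ ε * d := by positivity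
    linarith
  · linarith [hK d h]

theorem IsRecursive.totalWeight_tail (hp : IsRecursive p) (hf : ∀ k, 1 ≤ k → 0 < f k) {ε : ℝ}
    (hε : 0 ≤ ε) {K : ℕ} (hK : ∀ d, K + 1 ≤ d → f d ≤ ε * d) (n : ℕ) :
    |totalWeight f p n - ∑ k ∈ Finset.range K, f (k + 1) * degCount p (k + 1) n| ≤ 2 * ε * n := by
  have h1 : totalWeight f p n - ∑ k ∈ Finset.range K, f (k + 1) * degCount p (k + 1) n
      = ∑ i ∈ Finset.Icc 1 n, if K + 1 ≤ deg p i n then f (deg p i n) else 0 := by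
    simp_rw [degCount_eq_sum]
    rw [Finset.sum_comm, totalWeight, ← Finset.sum_sub_distrib]
    refine Finset.sum_congr rfl fun i _ => ?_
    have hd := hp.one_le_deg i n
    obtain ⟨d, hd⟩ := Nat.exists_eq_add_of_le' hd
    rw [hd]
    simp only [Nat.add_right_cancel_iff, Finset.sum_ite_eq, Finset.mem_range]
    split_ifs <;> first | omega | simp
  rw [h1, abs_of_nonneg]
  · calc _ ≤ ∑ i ∈ Finset.Icc 1 n, ε * (deg p i n : ℝ) := by
          refine Finset.sum_le_sum fun i _ => ?_
          split_ifs with h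
          · exact hK _ h
          · positivity
      _ = ε * ∑ i ∈ Finset.Icc 1 n, (deg p i n : ℝ) := by rw [Finset.mul_sum]
      _ ≤ ε * (2 * n) := by gcongr; exact hp.sum_deg_le_real n
      _ = _ := by ring
  · refine Finset.sum_nonneg fun i _ => ?_
    split_ifs with h
    · exact (hf _ (by omega)).le
    · exact le_rfl

/-- The probability that a vertex chosen from the tree at time `m` has degree `k` at time `n`. -/
noncomputable def attachDegProb (f : ℕ → ℝ) (p : ℕ → ℕ) (k n m : ℕ) : ℝ :=
  ∑ i ∈ Finset.Icc 1 n, if deg p i n = k then attachProb f p m i else 0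

theorem IsRecursive.attachProb_nonneg (hp : IsRecursive p) (hf : ∀ k, 1 ≤ k → 0 < f k)
    (m i : ℕ) : 0 ≤ attachProb f p m i := by
  have := fun i => (hf _ (hp.one_le_deg i m)).le
  unfold attachProb
  split_ifs
  · exact div_nonneg (this i) (Finset.sum_nonneg fun j _ => this j)
  · exact le_rfl

theorem IsRecursive.sum_attachProb_le (hp : IsRecursive p) (hf : ∀ k, 1 ≤ k → 0 < f k)
    (m : ℕ) (s : Finset ℕ) : ∑ i ∈ s, attachProb f p m i ≤ 1 := by
  have h0 := fun i => (hf _ (hp.one_le_deg i m)).le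
  calc ∑ i ∈ s, attachProb f p m i
      ≤ ∑ i ∈ s ∪ Finset.Icc 1 m, attachProb f p m i :=
        Finset.sum_le_sum_of_subset_of_nonneg Finset.subset_union_left
          fun i _ _ => hp.attachProb_nonneg hf m i
    _ = ∑ i ∈ Finset.Icc 1 m, attachProb f p m i :=
        (Finset.sum_subset Finset.subset_union_right fun i _ hi => if_neg hi).symm
    _ = ∑ i ∈ Finset.Icc 1 m, f (deg p i m) / totalWeight f p m :=
        Finset.sum_congr rfl fun i hi => if_pos hi
    _ = totalWeight f p m / totalWeight f p m := by rw [← Finset.sum_div]; rfl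
    _ ≤ 1 := div_self_le_one _

theorem IsRecursive.attachProb_le_one (hp : IsRecursive p) (hf : ∀ k, 1 ≤ k → 0 < f k)
    (m i : ℕ) : attachProb f p m i ≤ 1 := by
  simpa using hp.sum_attachProb_le hf m {i}

theorem IsRecursive.attachDegProb_mem (hp : IsRecursive p) (hf : ∀ k, 1 ≤ k → 0 < f k)
    (k n m : ℕ) : attachDegProb f p k n m ∈ Set.Icc (0 : ℝ) 1 := by
  unfold attachDegProb
  rw [← Finset.sum_filter]
  exact ⟨Finset.sum_nonneg fun i _ => hp.attachProb_nonneg hf m i, hp.sum_attachProb_le hf m _⟩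

theorem IsRecursive.weight_div_mem (hp : IsRecursive p) (hf : ∀ k, 1 ≤ k → 0 < f k)
    {k : ℕ} (hk : 1 ≤ k) (n : ℕ) :
    f k * degCount p k n / totalWeight f p n ∈ Set.Icc (0 : ℝ) 1 := by
  have h0 := fun i => (hf _ (hp.one_le_deg i n)).le
  have hle : f k * degCount p k n ≤ totalWeight f p n := by
    rw [degCount_eq_sum]
    refine Finset.sum_le_sum fun i _ => ?_
    split_ifs with h
    · rw [h]
    · exact h0 i
  have h1 : 0 ≤ totalWeight f p n := Finset.sum_nonneg fun i _ => h0 i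
  exact ⟨div_nonneg (mul_nonneg (hf k hk).le (by positivity)) h1, div_le_one_of_le₀ hle h1⟩

/-- At most `n - m` old vertices change degree and `n - m` are new, each costing `A`; the linear
parts `ε * deg` total at most `2 ε n` in each group. -/
theorem IsRecursive.totalWeight_sub_le (hp : IsRecursive p) (hf : ∀ k, 1 ≤ k → 0 < f k)
    {A ε : ℝ} (hA : 0 ≤ A) (hε : 0 ≤ ε) (hle : ∀ d, f d ≤ A + ε * d) {m n : ℕ} (hm : 1 ≤ m)
    (hmn : m ≤ n) :
    |totalWeight f p n - totalWeight f p m| ≤ 2 * A * ((n : ℝ) - m) + 4 * ε * n := by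
  have hun : Finset.Icc 1 n = Finset.Icc 1 m ∪ Finset.Ioc m n := by
    ext i; simp only [Finset.mem_Icc, Finset.mem_union, Finset.mem_Ioc]; omega
  have hdis : Disjoint (Finset.Icc 1 m) (Finset.Ioc m n) := by
    rw [Finset.disjoint_left]; intro i; simp only [Finset.mem_Icc, Finset.mem_Ioc]; omega
  have hchg : (((Finset.Icc 1 m).filter fun i => deg p i n ≠ deg p i m).card : ℝ) ≤ (n : ℝ) - m := by
    rw [← Nat.cast_sub hmn]; exact_mod_cast hp.card_changed_le hm hmn
  have hsub : ∀ s ⊆ Finset.Icc 1 n, ε * ∑ i ∈ s, (deg p i n : ℝ) ≤ 2 * ε * n := fun s hs => by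
    calc _ ≤ ε * ∑ i ∈ Finset.Icc 1 n, (deg p i n : ℝ) := by
          gcongr
      _ ≤ ε * (2 * n) := by gcongr; exact hp.sum_deg_le_real n
      _ = _ := by ring
  have h1 : totalWeight f p n - totalWeight f p m
      = ∑ i ∈ Finset.Icc 1 m, (f (deg p i n) - f (deg p i m))
        + ∑ i ∈ Finset.Ioc m n, f (deg p i n) := by
    rw [totalWeight, hun, Finset.sum_union hdis, totalWeight, Finset.sum_sub_distrib]
    ring
  have h2 : |∑ i ∈ Finset.Icc 1 m, (f (deg p i n) - f (deg p i m))|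
      ≤ A * ((n : ℝ) - m) + 2 * ε * n := by
    calc _ ≤ ∑ i ∈ Finset.Icc 1 m, |f (deg p i n) - f (deg p i m)| :=
          Finset.abs_sum_le_sum_abs _ _
      _ ≤ ∑ i ∈ Finset.Icc 1 m, ((if deg p i n ≠ deg p i m then A else 0)
            + ε * (deg p i n : ℝ)) := by
          refine Finset.sum_le_sum fun i _ => ?_
          split_ifs with h
          · have a1 := hf _ (hp.one_le_deg i n)
            have a2 := hf _ (hp.one_le_deg i m)
            have a3 := hle (deg p i n)
            have a4 := hle (deg p i m)
            have a5 : (deg p i m : ℝ) ≤ deg p i n := by exact_mod_cast hp.deg_mono i hmn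
            have a6 := mul_le_mul_of_nonneg_left a5 hε
            rw [abs_le]
            constructor <;> linarith
          · rw [not_not] at h
            rw [h]
            simpa using by positivity
      _ = A * ((Finset.Icc 1 m).filter fun i => deg p i n ≠ deg p i m).card
            + ε * ∑ i ∈ Finset.Icc 1 m, (deg p i n : ℝ) := by
          rw [Finset.sum_add_distrib, ← Finset.sum_filter, Finset.mul_sum]
          simp [mul_comm]
      _ ≤ _ := by
          have := hsub _ (Finset.Icc_subset_Icc_right (a := 1) hmn)
          gcongr
  have h3 : |∑ i ∈ Finset.Ioc m n, f (deg p i n)| ≤ A * ((n : ℝ) - m) + 2 * ε * n := by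
    rw [abs_of_nonneg (Finset.sum_nonneg fun i _ => (hf _ (hp.one_le_deg i n)).le)]
    calc _ ≤ ∑ i ∈ Finset.Ioc m n, (A + ε * (deg p i n : ℝ)) :=
          Finset.sum_le_sum fun i _ => hle _
      _ = A * ((n : ℝ) - m) + ε * ∑ i ∈ Finset.Ioc m n, (deg p i n : ℝ) := by
          rw [Finset.sum_add_distrib, ← Finset.mul_sum, Finset.sum_const, Nat.card_Ioc,
            nsmul_eq_mul, Nat.cast_sub hmn]
          ring
      _ ≤ _ := by
          have := hsub (Finset.Ioc m n) (hun ▸ Finset.subset_union_right)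
          linarith
  rw [h1]
  refine (abs_add_le _ _).trans ?_
  linarith

/-- A vertex of degree `k` at time `n` had degree at most `k` before, so only the bounded weights `f
j`, `j ≤ k`, enter. -/
theorem IsRecursive.weight_sub_le (hp : IsRecursive p) (hf : ∀ k, 1 ≤ k → 0 < f k)
    {F : ℝ} {k : ℕ} (hk : 1 ≤ k) (hF : ∀ j, j ≤ k → f j ≤ F) {m n : ℕ} (hm : 1 ≤ m)
    (hmn : m ≤ n) :
    |(∑ i ∈ Finset.Icc 1 m, if deg p i n = k then f (deg p i m) else 0) - f k * degCount p k n|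
      ≤ 2 * F * ((n : ℝ) - m) := by
  have hF0 : 0 ≤ F := (hf k hk).le.trans (hF k le_rfl)
  have hun : Finset.Icc 1 n = Finset.Icc 1 m ∪ Finset.Ioc m n := by
    ext i; simp only [Finset.mem_Icc, Finset.mem_union, Finset.mem_Ioc]; omega
  have hdis : Disjoint (Finset.Icc 1 m) (Finset.Ioc m n) := by
    rw [Finset.disjoint_left]; intro i; simp only [Finset.mem_Icc, Finset.mem_Ioc]; omega
  have hchg : (((Finset.Icc 1 m).filter fun i => deg p i n ≠ deg p i m).card : ℝ) ≤ (n : ℝ) - m := by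
    rw [← Nat.cast_sub hmn]; exact_mod_cast hp.card_changed_le hm hmn
  have h1 : (∑ i ∈ Finset.Icc 1 m, if deg p i n = k then f (deg p i m) else 0)
        - f k * degCount p k n
      = ∑ i ∈ Finset.Icc 1 m, (if deg p i n = k then f (deg p i m) - f k else 0)
        - ∑ i ∈ Finset.Ioc m n, if deg p i n = k then f k else 0 := by
    rw [degCount_eq_sum, hun, Finset.sum_union hdis, ← sub_sub, ← Finset.sum_sub_distrib]
    congr 1
    refine Finset.sum_congr rfl fun i _ => ?_
    split_ifs <;> simp
  have h2 : |∑ i ∈ Finset.Icc 1 m, (if deg p i n = k then f (deg p i m) - f k else 0)|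
      ≤ F * ((n : ℝ) - m) := by
    calc _ ≤ ∑ i ∈ Finset.Icc 1 m, |if deg p i n = k then f (deg p i m) - f k else 0| :=
          Finset.abs_sum_le_sum_abs _ _
      _ ≤ ∑ i ∈ Finset.Icc 1 m, (if deg p i n ≠ deg p i m then F else 0) := by
          refine Finset.sum_le_sum fun i _ => ?_
          by_cases h : deg p i n = k
          · rw [if_pos h]
            by_cases h' : deg p i n = deg p i m
            · rw [← h', h]; simp
            · rw [if_pos h']
              have a1 := hf _ (hp.one_le_deg i m)
              have a2 := hF _ ((hp.deg_mono i hmn).trans h.le)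
              have a3 := hF k le_rfl
              have a4 := hf k hk
              rw [abs_le]
              constructor <;> linarith
          · rw [if_neg h, abs_zero]
            split_ifs <;> linarith
      _ = F * ((Finset.Icc 1 m).filter fun i => deg p i n ≠ deg p i m).card := by
          rw [← Finset.sum_filter]
          simp [mul_comm]
      _ ≤ _ := by gcongr
  have h3 : |∑ i ∈ Finset.Ioc m n, if deg p i n = k then f k else 0| ≤ F * ((n : ℝ) - m) := by
    calc _ ≤ ∑ i ∈ Finset.Ioc m n, |if deg p i n = k then f k else 0| :=
          Finset.abs_sum_le_sum_abs _ _
      _ ≤ ∑ i ∈ Finset.Ioc m n, F := by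
          refine Finset.sum_le_sum fun i _ => ?_
          split_ifs
          · rw [abs_of_pos (hf k hk)]; exact hF k le_rfl
          · simpa using hF0
      _ = _ := by
          rw [Finset.sum_const, Nat.card_Ioc, nsmul_eq_mul, Nat.cast_sub hmn]
          ring
  rw [h1]
  refine (abs_sub _ _).trans ?_
  linarith

theorem attachDegProb_eq (f : ℕ → ℝ) (p : ℕ → ℕ) (k : ℕ) {m n : ℕ} (hmn : m ≤ n) :
    attachDegProb f p k n m
      = (∑ i ∈ Finset.Icc 1 m, if deg p i n = k then f (deg p i m) else 0)
        / totalWeight f p m := by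
  rw [attachDegProb, Finset.sum_div,
    ← Finset.sum_subset (Finset.Icc_subset_Icc_right hmn) fun i _ hi => by simp [attachProb, hi]]
  refine Finset.sum_congr rfl fun i hi => ?_
  rw [attachProb, if_pos hi]
  split_ifs <;> simp

theorem exists_attachDegProb_sub_le (hc : 0 < c) (hfc : ∀ k, 1 ≤ k → c ≤ f k)
    (hs : IsSublinear f) {k : ℕ} (hk : 1 ≤ k) {η : ℝ} (hη : 0 < η) :
    ∃ B : ℝ, 0 ≤ B ∧ ∀ p, IsRecursive p → ∀ m n, 1 ≤ m → m ≤ n →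
      |attachDegProb f p k n m - f k * degCount p k n / totalWeight f p n|
        ≤ B * (((n : ℝ) - m) / m) + η := by
  have hf : ∀ k, 1 ≤ k → 0 < f k := fun k hk => hc.trans_le (hfc k hk)
  have hfk := hf k hk
  -- The error `4 ε n` in the total weight contributes `4 ε f(k) n / (c² m)`, and `n / m = 1 + (n -
  -- m) / m`; this `ε` makes the part without delay equal to `η`.
  set ε := η * c ^ 2 / (4 * f k) with hεd
  have hε : 0 < ε := by positivity
  obtain ⟨A, hA, hle⟩ := hs.exists_le_add hε
  set F := A + ε * k with hFd
  have hF0 : 0 ≤ F := by positivity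
  have hF : ∀ j, j ≤ k → f j ≤ F := fun j hj => (hle j).trans (by
    have : (j : ℝ) ≤ k := by exact_mod_cast hj
    rw [hFd]; gcongr)
  refine ⟨2 * F / c + f k * (2 * A + 4 * ε) / c ^ 2, by positivity, fun p hp m n hm hmn => ?_⟩
  have hm0 : (0 : ℝ) < m := by exact_mod_cast hm
  have hn0 : (0 : ℝ) < n := by exact_mod_cast hm.trans hmn
  have hmn' : (m : ℝ) ≤ n := by exact_mod_cast hmn
  have hΨm := hp.le_totalWeight hfc m
  have hΨn := hp.le_totalWeight hfc n
  have hcm : 0 < c * m := by positivity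
  have hcn : 0 < c * n := by positivity
  have h1 := hp.weight_sub_le hf hk hF hm hmn
  have h2 := hp.totalWeight_sub_le hf hA hε.le hle hm hmn
  rw [attachDegProb_eq f p k hmn]
  set S := ∑ i ∈ Finset.Icc 1 m, if deg p i n = k then f (deg p i m) else 0
  set D := f k * (degCount p k n : ℝ) with hD
  set U := totalWeight f p m
  set V := totalWeight f p n
  have hU : 0 < U := hcm.trans_le hΨm
  have hV : 0 < V := hcn.trans_le hΨn
  have hD0 : 0 ≤ D := by positivity
  have hDn : D ≤ f k * n := by
    have : (degCount p k n : ℝ) ≤ n := by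
      have := Finset.card_filter_le (Finset.Icc 1 n) fun i => deg p i n = k
      rw [Nat.card_Icc] at this
      exact_mod_cast this
    rw [hD]; gcongr
  have e : S / U - D / V = (S - D) / U + D * (V - U) / (U * V) := by
    field_simp
    ring
  have b1 : |(S - D) / U| ≤ 2 * F * ((n : ℝ) - m) / (c * m) := by
    rw [abs_div, abs_of_pos hU]
    have : 0 ≤ (n : ℝ) - m := by linarith
    gcongr
  have b2 : |D * (V - U) / (U * V)|
      ≤ (f k * n) * (2 * A * ((n : ℝ) - m) + 4 * ε * n) / ((c * m) * (c * n)) := by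
    rw [abs_div, abs_mul, abs_of_nonneg hD0, abs_of_pos (mul_pos hU hV)]
    have : 0 ≤ (n : ℝ) - m := by linarith
    gcongr
  rw [e]
  refine (abs_add_le _ _).trans ((add_le_add b1 b2).trans (le_of_eq ?_))
  have hη' : η = 4 * ε * f k / c ^ 2 := by rw [hεd]; field_simp
  rw [hη']
  field_simp
  ring

end Weights

/-! ### Averaging over the delay -/

section Delay

variable {β : ℝ}

theorem one_le_snapshot (β : ℝ) (n : ℕ) (x : ℝ) : 1 ≤ snapshot β n x := le_max_right _ _

theorem snapshot_le {n : ℕ} (hn : 1 ≤ n) {x : ℝ} (hx : 0 ≤ x) : snapshot β n x ≤ n := by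
  refine max_le ?_ hn
  have h : (n : ℝ) - (n : ℝ) ^ β * x ≤ n := by
    have : 0 ≤ (n : ℝ) ^ β * x := by positivity
    linarith
  exact (Nat.floor_le_floor h).trans (by simp)

theorem measurable_snapshot (β : ℝ) (n : ℕ) : Measurable (snapshot β n) := by
  unfold snapshot
  have : Measurable fun x : ℝ => ⌊(n : ℝ) - (n : ℝ) ^ β * x⌋₊ :=
    Nat.measurable_floor.comp (by fun_prop)
  exact this.max measurable_const

theorem tendsto_snapshot_ratio (hβ : β < 1) {x : ℝ} (hx : 0 ≤ x) :
    Tendsto (fun n : ℕ => ((n : ℝ) - snapshot β n x) / snapshot β n x) atTop (𝓝 0) := by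
  have h1 : Tendsto (fun n : ℕ => (n : ℝ) ^ (β - 1) * x + 1 / (n : ℝ)) atTop (𝓝 0) := by
    have a := (tendsto_rpow_neg_atTop (by linarith : 0 < 1 - β)).comp
      (tendsto_natCast_atTop_atTop (R := ℝ))
    have b := (a.mul_const x).add tendsto_one_div_atTop_nhds_zero_nat
    simpa [Function.comp_def] using b
  have h2 : Tendsto (fun n : ℕ => (snapshot β n x : ℝ) / n) atTop (𝓝 1) := by
    have h3 : Tendsto (fun n : ℕ => 1 - ((n : ℝ) ^ (β - 1) * x + 1 / (n : ℝ))) atTop (𝓝 1) := by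
      simpa using h1.const_sub 1
    refine tendsto_of_tendsto_of_tendsto_of_le_of_le' h3 tendsto_const_nhds ?_ ?_
    · filter_upwards [eventually_ge_atTop 1] with n hn
      have hn0 : (0 : ℝ) < n := by exact_mod_cast hn
      have h4 : (n : ℝ) - (n : ℝ) ^ β * x - 1 ≤ snapshot β n x := by
        have := (Nat.lt_floor_add_one ((n : ℝ) - (n : ℝ) ^ β * x)).le
        have h5 : ((⌊(n : ℝ) - (n : ℝ) ^ β * x⌋₊ : ℕ) : ℝ) ≤ snapshot β n x := by
          exact_mod_cast le_max_left _ _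
        linarith
      rw [le_div_iff₀ hn0, Real.rpow_sub_one hn0.ne']
      calc _ = (n : ℝ) - (n : ℝ) ^ β * x - 1 := by field_simp; ring
        _ ≤ _ := h4
    · filter_upwards [eventually_ge_atTop 1] with n hn
      have hn0 : (0 : ℝ) < n := by exact_mod_cast hn
      rw [div_le_one hn0]
      exact_mod_cast snapshot_le hn hx
  have h3 := (h2.inv₀ one_ne_zero).sub_const 1
  rw [inv_one, sub_self] at h3
  refine h3.congr fun n => ?_
  have : (snapshot β n x : ℝ) ≠ 0 := by
    have := one_le_snapshot β n x
    positivity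
  rw [inv_div]
  field_simp

/-- The average of `attachDegProb` over the delay. -/
noncomputable def meanAttach (f : ℕ → ℝ) (β : ℝ) (μ : Measure ℝ) (p : ℕ → ℕ) (k n : ℕ) : ℝ :=
  ∫ x, attachDegProb f p k n (snapshot β n x) ∂μ

theorem measurable_attachDegProb_snapshot (f : ℕ → ℝ) (p : ℕ → ℕ) (k n : ℕ) :
    Measurable fun x => attachDegProb f p k n (snapshot β n x) :=
  (measurable_of_countable fun m => attachDegProb f p k n m).comp (measurable_snapshot β n)

theorem meanAttach_mem {f : ℕ → ℝ} {p : ℕ → ℕ} (hp : IsRecursive p) (hf : ∀ k, 1 ≤ k → 0 < f k)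
    (μ : Measure ℝ) [IsProbabilityMeasure μ] (k n : ℕ) :
    meanAttach f β μ p k n ∈ Set.Icc (0 : ℝ) 1 := by
  refine ⟨integral_nonneg fun x => (hp.attachDegProb_mem hf k n _).1, ?_⟩
  have := integral_mono_of_nonneg (μ := μ) (f := fun x => attachDegProb f p k n (snapshot β n x))
    (g := fun _ => (1 : ℝ)) (ae_of_all _ fun x => (hp.attachDegProb_mem hf k n _).1)
    (integrable_const _) (ae_of_all _ fun x => (hp.attachDegProb_mem hf k n _).2)
  simpa [meanAttach] using this

/-- The bound for a fixed snapshot depends on the tree only through `m` and `n`, so dominated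
convergence over the delay is uniform in the tree. -/
theorem eventually_meanAttach_sub_le (hβ : β < 1) (μ : Measure ℝ) [IsProbabilityMeasure μ]
    (hμ0 : ∀ᵐ x ∂μ, 0 ≤ x) {f : ℕ → ℝ} {c : ℝ} (hc : 0 < c) (hfc : ∀ k, 1 ≤ k → c ≤ f k)
    (hs : IsSublinear f) {k : ℕ} (hk : 1 ≤ k) {η : ℝ} (hη : 0 < η) :
    ∀ᶠ n : ℕ in atTop, ∀ p, IsRecursive p →
      |meanAttach f β μ p k n - f k * degCount p k n / totalWeight f p n| ≤ η := by
  have hf : ∀ k, 1 ≤ k → 0 < f k := fun k hk => hc.trans_le (hfc k hk)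
  obtain ⟨B, hB, hbd⟩ := exists_attachDegProb_sub_le hc hfc hs hk (half_pos hη)
  -- Both compared quantities lie in `[0, 1]`, so the error may be clipped at 1; this supplies the
  -- dominating function.
  let g : ℕ → ℝ → ℝ := fun n x =>
    min 1 |B * (((n : ℝ) - snapshot β n x) / snapshot β n x)|
  have hg0 : ∀ n x, 0 ≤ g n x := fun n x => le_min zero_le_one (abs_nonneg _)
  have hgm : ∀ n, Measurable (g n) := fun n =>
    (measurable_of_countable fun m : ℕ => min 1 |B * (((n : ℝ) - m) / m)|).comp
      (measurable_snapshot β n)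
  have hgi : ∀ n, Integrable (g n) μ := fun n =>
    (integrable_const (1 : ℝ)).mono' (hgm n).aestronglyMeasurable (ae_of_all _ fun x => by
      rw [Real.norm_eq_abs, abs_of_nonneg (hg0 n x)]; exact min_le_left _ _)
  have hlim : Tendsto (fun n => ∫ x, g n x ∂μ) atTop (𝓝 (∫ _, 0 ∂μ)) := by
    refine tendsto_integral_of_dominated_convergence (fun _ => 1)
      (fun n => (hgm n).aestronglyMeasurable) (integrable_const _) (fun n => ae_of_all _ fun x => ?_)
      ?_
    · rw [Real.norm_eq_abs, abs_of_nonneg (hg0 n x)]; exact min_le_left _ _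
    · filter_upwards [hμ0] with x hx
      have := ((tendsto_snapshot_ratio hβ hx).const_mul B).abs
      rw [mul_zero, abs_zero] at this
      have h1 := (tendsto_const_nhds (x := (1 : ℝ))).min this
      rwa [min_eq_right zero_le_one] at h1
  rw [integral_zero] at hlim
  filter_upwards [hlim.eventually (gt_mem_nhds (half_pos hη)), eventually_ge_atTop 1]
    with n hn hn1 p hp
  set a := f k * degCount p k n / totalWeight f p n with ha
  have hint : Integrable (fun x => attachDegProb f p k n (snapshot β n x)) μ :=
    (integrable_const (1 : ℝ)).mono'
      (measurable_attachDegProb_snapshot f p k n).aestronglyMeasurable (ae_of_all _ fun x => by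
        have := hp.attachDegProb_mem hf k n (snapshot β n x)
        rw [Real.norm_eq_abs, abs_of_nonneg this.1]; exact this.2)
  have e : meanAttach f β μ p k n - a
      = ∫ x, (attachDegProb f p k n (snapshot β n x) - a) ∂μ := by
    rw [integral_sub hint (integrable_const _), integral_const]
    simp [meanAttach]
  rw [e]
  calc |∫ x, (attachDegProb f p k n (snapshot β n x) - a) ∂μ|
      ≤ ∫ x, |attachDegProb f p k n (snapshot β n x) - a| ∂μ := abs_integral_le_integral_abs
    _ ≤ ∫ x, (g n x + η / 2) ∂μ := by
        refine integral_mono_of_nonneg (ae_of_all _ fun x => abs_nonneg _)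
          ((hgi n).add (integrable_const _)) ?_
        filter_upwards [hμ0] with x hx
        have h1 := hbd p hp (snapshot β n x) n (one_le_snapshot β n x) (snapshot_le hn1 hx)
        have h2 := hp.attachDegProb_mem hf k n (snapshot β n x)
        have h3 := hp.weight_div_mem hf hk n
        rw [← ha] at h1 h3
        have h4 : |attachDegProb f p k n (snapshot β n x) - a| ≤ 1 := by
          rw [abs_le]; constructor <;> linarith [h2.1, h2.2, h3.1, h3.2]
        have h5 := le_abs_self (B * (((n : ℝ) - snapshot β n x) / snapshot β n x))
        rcases min_choice (1 : ℝ) |B * (((n : ℝ) - snapshot β n x) / snapshot β n x)| with h | h <;>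
          simp only [g, h] <;> linarith
    _ = ∫ x, g n x ∂μ + η / 2 := by
        rw [integral_add (hgi n) (integrable_const _), integral_const]; simp
    _ ≤ η := by linarith

end Delay

/-! ### A strong law for bounded orthogonal increments -/

section StrongLaw

variable {Ω : Type*} [MeasurableSpace Ω] {P : Measure Ω} [IsProbabilityMeasure P]

theorem integrable_of_ae_abs_le {g : Ω → ℝ} (hg : AEStronglyMeasurable g P) {B : ℝ}
    (hB : ∀ᵐ ω ∂P, |g ω| ≤ B) : Integrable g P :=
  (integrable_const B).mono' hg (by simpa using hB)

/-- Orthogonality gives `E[S_n²] ≤ n`. Hence `S_{r²} / r² → 0` almost surely, and bounded increments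
fill the gaps between consecutive squares. -/
theorem ae_isLittleO_sum_of_orthogonal {d : ℕ → Ω → ℝ} (hm : ∀ n, Measurable (d n))
    (hb : ∀ n, ∀ᵐ ω ∂P, |d n ω| ≤ 1)
    (horth : ∀ n, ∫ ω, (∑ i ∈ Finset.range n, d i ω) * d n ω ∂P = 0) :
    ∀ᵐ ω ∂P, (fun n => ∑ i ∈ Finset.range n, d i ω) =o[atTop] fun n : ℕ => (n : ℝ) := by
  have hball : ∀ᵐ ω ∂P, ∀ n, |d n ω| ≤ 1 := ae_all_iff.2 hb
  let S : ℕ → Ω → ℝ := fun n ω => ∑ i ∈ Finset.range n, d i ω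
  have hSm : ∀ n, Measurable (S n) := fun n => Finset.measurable_fun_sum _ fun i _ => hm i
  have hinc : ∀ ω, (∀ n, |d n ω| ≤ 1) → ∀ m n, m ≤ n → |S n ω| ≤ |S m ω| + ((n : ℝ) - m) := by
    intro ω hω m n hmn
    induction n, hmn using Nat.le_induction with
    | base => simp
    | succ n _ ih =>
      simp only [S, Finset.sum_range_succ] at ih ⊢
      refine (abs_add_le _ _).trans ?_
      push_cast
      linarith [hω n]
  have hSb : ∀ n, ∀ᵐ ω ∂P, |S n ω| ≤ n := fun n => by
    filter_upwards [hball] with ω hω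
    simpa [S] using hinc ω hω 0 n (by omega)
  have hint : ∀ n, Integrable (fun ω => S n ω ^ 2) P := fun n => by
    refine integrable_of_ae_abs_le ((hSm n).pow_const 2).aestronglyMeasurable (B := (n : ℝ) ^ 2) ?_
    filter_upwards [hSb n] with ω hω
    rw [abs_pow]
    gcongr
  have hsq : ∀ n, ∫ ω, S n ω ^ 2 ∂P ≤ n := by
    intro n
    induction n with
    | zero => simp [S]
    | succ n ih =>
      have e : ∀ ω, S (n + 1) ω ^ 2 = S n ω ^ 2 + (2 * (S n ω * d n ω) + d n ω ^ 2) := fun ω => by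
        simp only [S, Finset.sum_range_succ]; ring
      have i1 : Integrable (fun ω => S n ω * d n ω) P := by
        refine integrable_of_ae_abs_le ((hSm n).mul (hm n)).aestronglyMeasurable (B := n) ?_
        filter_upwards [hSb n, hb n] with ω h1 h2
        rw [abs_mul]
        nlinarith [abs_nonneg (S n ω), abs_nonneg (d n ω)]
      have hd2 : ∀ᵐ ω ∂P, d n ω ^ 2 ≤ 1 := by
        filter_upwards [hb n] with ω h
        exact (sq_le_one_iff_abs_le_one _).2 h
      have i2 : Integrable (fun ω => d n ω ^ 2) P := by
        refine integrable_of_ae_abs_le ((hm n).pow_const 2).aestronglyMeasurable (B := 1) ?_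
        filter_upwards [hd2] with ω h
        rwa [abs_of_nonneg (sq_nonneg _)]
      have i3 : Integrable (fun ω => 2 * (S n ω * d n ω) + d n ω ^ 2) P := (i1.const_mul 2).add i2
      simp_rw [e]
      rw [integral_add (hint n) i3, integral_add (i1.const_mul 2) i2,
        integral_const_mul, horth n]
      have : ∫ ω, d n ω ^ 2 ∂P ≤ 1 := by
        have := integral_mono_ae i2 (integrable_const (1 : ℝ)) hd2
        simpa using this
      push_cast
      linarith
  -- The expectations are at most `1 / r²`, so the series has finite expectation and its terms tend
  -- to 0 almost surely.
  have hsub : ∀ᵐ ω ∂P, Tendsto (fun r : ℕ => S (r ^ 2) ω ^ 2 / (r : ℝ) ^ 4) atTop (𝓝 0) := by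
    have hmeas : ∀ r : ℕ, Measurable fun ω => ENNReal.ofReal (S (r ^ 2) ω ^ 2 / (r : ℝ) ^ 4) :=
      fun r => (((hSm _).pow_const 2).div_const _).ennreal_ofReal
    have hfin : ∫⁻ ω, ∑' r : ℕ, ENNReal.ofReal (S (r ^ 2) ω ^ 2 / (r : ℝ) ^ 4) ∂P ≠ ⊤ := by
      rw [lintegral_tsum fun r => (hmeas r).aemeasurable]
      have hle : ∀ r : ℕ, ∫⁻ ω, ENNReal.ofReal (S (r ^ 2) ω ^ 2 / (r : ℝ) ^ 4) ∂P
          ≤ ENNReal.ofReal (1 / (r : ℝ) ^ 2) := by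
        intro r
        rw [← ofReal_integral_eq_lintegral_ofReal ((hint _).div_const _)
          (ae_of_all _ fun ω => by positivity), integral_div]
        refine ENNReal.ofReal_le_ofReal ?_
        have := hsq (r ^ 2)
        push_cast at this
        calc (∫ ω, S (r ^ 2) ω ^ 2 ∂P) / (r : ℝ) ^ 4 ≤ (r : ℝ) ^ 2 / (r : ℝ) ^ 4 := by gcongr
          _ = 1 / (r : ℝ) ^ 2 := by
            rcases eq_or_ne (r : ℝ) 0 with h | h
            · simp [h]
            · field_simp
      refine ne_top_of_le_ne_top ?_ (ENNReal.tsum_le_tsum hle)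
      rw [← ENNReal.ofReal_tsum_of_nonneg (fun r => by positivity)
        (Real.summable_one_div_nat_pow.2 one_lt_two)]
      exact ENNReal.ofReal_ne_top
    filter_upwards [ae_lt_top (Measurable.tsum hmeas) hfin] with ω hω
    have h1 := ENNReal.tendsto_atTop_zero_of_tsum_ne_top hω.ne
    have h2 := (ENNReal.tendsto_toReal ENNReal.zero_ne_top).comp h1
    refine h2.congr fun r => ?_
    exact ENNReal.toReal_ofReal (by positivity)
  filter_upwards [hsub, hball] with ω hω hd
  rw [Asymptotics.isLittleO_iff]
  intro ε hε
  have hsqrt : Tendsto Nat.sqrt atTop atTop := by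
    refine tendsto_atTop_mono (f := fun n => Nat.sqrt n) (fun n => le_rfl) ?_
    refine tendsto_atTop_atTop.2 fun b => ⟨b * b, fun a ha => Nat.le_sqrt.2 ha⟩
  have h1 := hsqrt.eventually (hω.eventually (gt_mem_nhds (by positivity : 0 < (ε / 2) ^ 2)))
  have h2 : ∀ᶠ n : ℕ in atTop, 4 / ε ≤ (Nat.sqrt n : ℝ) :=
    (tendsto_natCast_atTop_atTop.comp hsqrt).eventually_ge_atTop _
  filter_upwards [h1, h2] with n h1 h2
  set r := Nat.sqrt n with hr
  have hr0 : (0 : ℝ) < r := lt_of_lt_of_le (by positivity) h2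
  have hrn : r ^ 2 ≤ n := Nat.sqrt_le' n
  have hrn' : (r : ℝ) ^ 2 ≤ n := by exact_mod_cast hrn
  have hnr : (n : ℝ) - ((r ^ 2 : ℕ) : ℝ) ≤ 2 * r := by
    have := Nat.sqrt_le_add n
    have : (n : ℝ) ≤ r * r + r + r := by exact_mod_cast this
    push_cast
    nlinarith
  have h3 : |S (r ^ 2) ω| ≤ ε / 2 * r ^ 2 := by
    rw [div_lt_iff₀ (by positivity)] at h1
    refine abs_le_of_sq_le_sq ?_ (by positivity)
    nlinarith
  have h4 := hinc ω hd _ _ hrn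
  rw [div_le_iff₀ hε] at h2
  rw [Real.norm_eq_abs, Real.norm_eq_abs, Nat.abs_cast]
  change |S n ω| ≤ _
  nlinarith

end StrongLaw

/-! ### Locality of the tree functionals -/

section Locality

variable {f : ℕ → ℝ} {p q : ℕ → ℕ} {n : ℕ}

/-- Functionals of the path up to time `n` thereby factor through `treeAt`, which takes values in a
countable type; this settles all measurability questions. -/
theorem children_congr (h : ∀ j ∈ Finset.Icc 2 n, p j = q j) (i : ℕ) {m : ℕ} (hm : m ≤ n) :
    children p i m = children q i m := by
  unfold children
  congr 1
  exact Finset.filter_congr fun j hj => by rw [h j (Finset.Icc_subset_Icc_right hm hj)]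

theorem deg_congr (h : ∀ j ∈ Finset.Icc 2 n, p j = q j) (i : ℕ) {m : ℕ} (hm : m ≤ n) :
    deg p i m = deg q i m := by
  unfold deg
  rw [children_congr h i hm]

theorem attachProb_congr (h : ∀ j ∈ Finset.Icc 2 n, p j = q j) (i : ℕ) {m : ℕ} (hm : m ≤ n) :
    attachProb f p m i = attachProb f q m i := by
  unfold attachProb totalWeight
  simp_rw [deg_congr h _ hm]

theorem meanAttach_congr {β : ℝ} {μ : Measure ℝ} (hμ0 : ∀ᵐ x ∂μ, 0 ≤ x)
    (h : ∀ j ∈ Finset.Icc 2 n, p j = q j) (k : ℕ) (hn : 1 ≤ n) :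
    meanAttach f β μ p k n = meanAttach f β μ q k n := by
  refine integral_congr_ae ?_
  filter_upwards [hμ0] with x hx
  refine Finset.sum_congr rfl fun i _ => ?_
  rw [deg_congr h i le_rfl, attachProb_congr h i (snapshot_le hn hx)]

/-- The difference between the indicator that the vertex `n + 1` is attached to a vertex of degree
`k` and its conditional probability given the tree at time `n`. -/
noncomputable def noise (f : ℕ → ℝ) (β : ℝ) (μ : Measure ℝ) (k : ℕ) (p : ℕ → ℕ) (n : ℕ) : ℝ :=
  if 2 ≤ n then (if deg p (p (n + 1)) n = k then 1 else 0) - meanAttach f β μ p k n else 0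

theorem noise_congr {β : ℝ} {μ : Measure ℝ} (hμ0 : ∀ᵐ x ∂μ, 0 ≤ x) {m : ℕ} (hm : m + 1 ≤ n)
    (h : ∀ j ∈ Finset.Icc 2 n, p j = q j) (k : ℕ) :
    noise f β μ k p m = noise f β μ k q m := by
  unfold noise
  by_cases h2 : 2 ≤ m
  · rw [if_pos h2, if_pos h2, h (m + 1) (Finset.mem_Icc.2 ⟨by omega, hm⟩), deg_congr h _ (by omega : m ≤ n),
      meanAttach_congr hμ0 (fun j hj => h j (Finset.Icc_subset_Icc_right (by omega) hj)) k
        (by omega)]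
  · rw [if_neg h2, if_neg h2]

theorem IsRecursive.abs_noise_le {β : ℝ} {μ : Measure ℝ} [IsProbabilityMeasure μ]
    (hp : IsRecursive p) (hf : ∀ k, 1 ≤ k → 0 < f k) (k n : ℕ) : |noise f β μ k p n| ≤ 1 := by
  unfold noise
  have := meanAttach_mem (β := β) hp hf μ k n
  rw [abs_le]
  split_ifs <;> constructor <;> linarith [this.1, this.2]

/-- The parent map that agrees with `t` on `{2, …, n}` and vanishes elsewhere. -/
def extendTree (n : ℕ) (t : Finset.Icc 2 n → ℕ) (j : ℕ) : ℕ :=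
  if h : j ∈ Finset.Icc 2 n then t ⟨j, h⟩ else 0

theorem extendTree_treeAt {Ω : Type*} (par : ℕ → Ω → ℕ) (n : ℕ) (ω : Ω) :
    ∀ j ∈ Finset.Icc 2 n, par j ω = extendTree n (treeAt par n ω) j := fun j hj => by
  rw [extendTree, dif_pos hj]; rfl

end Locality

/-! ### The attachment probabilities given the tree -/

namespace IsDelayTree

variable {Ω : Type*} [MeasurableSpace Ω] {P : Measure Ω} {β : ℝ} {μ : Measure ℝ} {f : ℕ → ℝ} {ξ : ℕ → Ω → ℝ} {par : ℕ → Ω → ℕ}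

theorem measurable_treeAt (hT : IsDelayTree P β μ f ξ par) (n : ℕ) : Measurable (treeAt par n) :=
  measurable_pi_lambda _ fun j => hT.measurable_par j

theorem ae_delay_nonneg (hT : IsDelayTree P β μ f ξ par) (hμ0 : ∀ᵐ x ∂μ, 0 ≤ x) {n : ℕ}
    (hn : 2 ≤ n) : ∀ᵐ ω ∂P, 0 ≤ ξ (n + 1) ω := by
  rw [← hT.law_delay n hn] at hμ0
  exact ae_of_ae_map (hT.measurable_delay _).aemeasurable hμ0

theorem measurableSet_par_eq (hT : IsDelayTree P β μ f ξ par) (n i : ℕ) :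
    MeasurableSet {ω | par n ω = i} := hT.measurable_par n (measurableSet_singleton i)

theorem comap_le (hT : IsDelayTree P β μ f ξ par) (n : ℕ) :
    MeasurableSpace.comap (fun ω => (treeAt par n ω, ξ (n + 1) ω)) inferInstance
      ≤ (inferInstance : MeasurableSpace Ω) :=
  ((hT.measurable_treeAt n).prodMk (hT.measurable_delay (n + 1))).comap_le

variable [IsProbabilityMeasure P]

/-- With nonnegative delay the snapshot is at most `n`, so each vertex outside `{1, …, n}` has
conditional probability 0, and there are countably many of them. -/
theorem ae_isRecursive (hT : IsDelayTree P β μ f ξ par) (hμ0 : ∀ᵐ x ∂μ, 0 ≤ x) :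
    ∀ᵐ ω ∂P, IsRecursive fun j => par j ω := by
  refine ae_all_iff.2 fun n => ?_
  by_cases hn1 : 1 ≤ n
  swap
  · exact ae_of_all _ fun ω h => absurd h hn1
  rcases Nat.lt_or_ge n 2 with h | hn
  · obtain rfl : n = 1 := by omega
    filter_upwards [hT.par_two] with ω hω _
    simpa using hω
  have key : ∀ i, i ∉ Finset.Icc 1 n → ∀ᵐ ω ∂P, par (n + 1) ω ≠ i := by
    intro i hi
    have hms := hT.measurableSet_par_eq (n + 1) i
    have h1 : ∫ ω, ({ω | par (n + 1) ω = i}.indicator fun _ => (1 : ℝ)) ω ∂P = 0 := by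
      rw [← integral_condExp (hT.comap_le n), integral_congr_ae (hT.attach n hn i)]
      refine integral_eq_zero_of_ae ?_
      filter_upwards [hT.ae_delay_nonneg hμ0 hn] with ω hω
      refine if_neg fun h => hi (Finset.Icc_subset_Icc_right (snapshot_le hn1 hω) h)
    rw [integral_indicator_const _ hms, smul_eq_mul, mul_one, measureReal_eq_zero_iff] at h1
    exact measure_eq_zero_iff_ae_notMem.1 h1
  have : ∀ᵐ ω ∂P, ∀ i, i ∉ Finset.Icc 1 n → par (n + 1) ω ≠ i :=
    ae_all_iff.2 fun i => by
      by_cases hi : i ∈ Finset.Icc 1 n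
      · exact ae_of_all _ fun ω h => absurd hi h
      · filter_upwards [key i hi] with ω hω _ using hω
  filter_upwards [this] with ω hω _
  by_contra h
  exact hω _ h rfl

variable [IsProbabilityMeasure μ]

/-- A function of the tree is pulled out of the conditional expectation; then independence of the
delay turns the joint law into a product, and Fubini averages over `μ`. -/
theorem integral_mul_par_eq (hT : IsDelayTree P β μ f ξ par) (hμ0 : ∀ᵐ x ∂μ, 0 ≤ x)
    (hf : ∀ k, 1 ≤ k → 0 < f k) {n : ℕ} (hn : 2 ≤ n) (i : ℕ) (h : (Finset.Icc 2 n → ℕ) → ℝ)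
    {B : ℝ} (hB : ∀ᵐ ω ∂P, |h (treeAt par n ω)| ≤ B) :
    ∫ ω, h (treeAt par n ω) * ({ω | par (n + 1) ω = i}.indicator fun _ => (1 : ℝ)) ω ∂P
      = ∫ ω, h (treeAt par n ω)
          * ∫ x, attachProb f (fun j => par j ω) (snapshot β n x) i ∂μ ∂P := by
  have hTm := hT.measurable_treeAt n
  have hXm := hT.measurable_delay (n + 1)
  have hhm : Measurable h := measurable_of_countable h
  have hms := hT.measurableSet_par_eq (n + 1) i
  have hrec := hT.ae_isRecursive hμ0
  have hnn := hT.ae_delay_nonneg hμ0 hn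
  let I : Ω → ℝ := {ω | par (n + 1) ω = i}.indicator fun _ => (1 : ℝ)
  have hIint : Integrable I P := (integrable_const (1 : ℝ)).indicator hms
  have hhI : Integrable ((fun ω => h (treeAt par n ω)) * I) P := by
    refine integrable_of_ae_abs_le (B := B)
      ((hhm.comp hTm).aestronglyMeasurable.mul hIint.aestronglyMeasurable) ?_
    filter_upwards [hB] with ω hω
    by_cases hi : par (n + 1) ω = i
    · simpa [I, hi] using hω
    · simpa [I, hi] using (abs_nonneg _).trans hω
  let G : (Finset.Icc 2 n → ℕ) × ℝ → ℝ := fun z =>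
    attachProb f (extendTree n z.1) (snapshot β n z.2) i
  have hG : Measurable G := by
    refine measurable_from_prod_countable_right fun t => ?_
    exact (measurable_of_countable fun m => attachProb f (extendTree n t) m i).comp
      (measurable_snapshot β n)
  have hGeq : ∀ ω x, 0 ≤ x →
      attachProb f (fun j => par j ω) (snapshot β n x) i = G (treeAt par n ω, x) :=
    fun ω x hx => attachProb_congr (extendTree_treeAt par n ω) i (snapshot_le (by omega) hx)
  have hhG : Integrable (fun ω => h (treeAt par n ω) * G (treeAt par n ω, ξ (n + 1) ω)) P := by
    refine integrable_of_ae_abs_le (B := B)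
      ((hhm.comp hTm).mul (hG.comp (hTm.prodMk hXm))).aestronglyMeasurable ?_
    filter_upwards [hB, hrec, hnn] with ω hω hr hx
    rw [← hGeq ω _ hx, abs_mul, abs_of_nonneg (hr.attachProb_nonneg hf _ _)]
    have h1 := hr.attachProb_le_one hf (snapshot β n (ξ (n + 1) ω)) i
    have h2 := hr.attachProb_nonneg hf (snapshot β n (ξ (n + 1) ω)) i
    nlinarith [abs_nonneg (h (treeAt par n ω))]
  have hstep1 : ∫ ω, h (treeAt par n ω) * I ω ∂P
      = ∫ ω, h (treeAt par n ω) * G (treeAt par n ω, ξ (n + 1) ω) ∂P := by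
    have hsm : StronglyMeasurable[MeasurableSpace.comap
        (fun ω => (treeAt par n ω, ξ (n + 1) ω)) inferInstance] fun ω => h (treeAt par n ω) := by
      have : Measurable[MeasurableSpace.comap
        (fun ω => (treeAt par n ω, ξ (n + 1) ω)) inferInstance] fun ω => h (treeAt par n ω) :=
        (hhm.comp measurable_fst).comp (comap_measurable _)
      exact this.stronglyMeasurable
    have h1 := condExp_mul_of_stronglyMeasurable_left hsm hhI hIint
    have h2 := integral_condExp (μ := P) (hT.comap_le n)
      (f := (fun ω => h (treeAt par n ω)) * I)
    calc ∫ ω, h (treeAt par n ω) * I ω ∂P = _ := h2.symm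
      _ = _ := integral_congr_ae (h1.trans ?_)
    filter_upwards [hT.attach n hn i, hnn] with ω hω hx
    simp only [Pi.mul_apply]
    rw [hω, hGeq ω _ hx]
  have hmap : P.map (fun ω => (treeAt par n ω, ξ (n + 1) ω))
      = (P.map (treeAt par n)).prod μ := by
    rw [← hT.law_delay n hn]
    exact (indepFun_iff_map_prod_eq_prod_map_map hTm.aemeasurable hXm.aemeasurable).1
      (hT.indep_delay n hn).symm
  have hprodm : Measurable fun z : (Finset.Icc 2 n → ℕ) × ℝ => h z.1 * G z :=
    (hhm.comp measurable_fst).mul hG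
  have hpint : Integrable (fun z : (Finset.Icc 2 n → ℕ) × ℝ => h z.1 * G z)
      ((P.map (treeAt par n)).prod μ) := by
    rw [← hmap, integrable_map_measure hprodm.aestronglyMeasurable (hTm.prodMk hXm).aemeasurable]
    exact hhG
  have : IsProbabilityMeasure (P.map (treeAt par n)) :=
    Measure.isProbabilityMeasure_map hTm.aemeasurable
  calc ∫ ω, h (treeAt par n ω) * I ω ∂P
      = ∫ ω, h (treeAt par n ω) * G (treeAt par n ω, ξ (n + 1) ω) ∂P := hstep1
    _ = ∫ z, h z.1 * G z ∂(P.map fun ω => (treeAt par n ω, ξ (n + 1) ω)) :=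
        (integral_map (hTm.prodMk hXm).aemeasurable hprodm.aestronglyMeasurable).symm
    _ = ∫ t, ∫ x, h t * G (t, x) ∂μ ∂(P.map (treeAt par n)) := by
        rw [hmap, integral_prod _ hpint]
    _ = ∫ ω, ∫ x, h (treeAt par n ω) * G (treeAt par n ω, x) ∂μ ∂P :=
        integral_map hTm.aemeasurable (measurable_of_countable _).aestronglyMeasurable
    _ = _ := by
        refine integral_congr_ae (ae_of_all _ fun ω => ?_)
        simp only
        rw [integral_const_mul]
        congr 1
        refine integral_congr_ae ?_
        filter_upwards [hμ0] with x hx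
        exact (hGeq ω x hx).symm

/-- Split according to the parent `i`: the event that `i` has degree `k` depends on the tree alone
and can be absorbed into `h`. -/
theorem integral_mul_deg_par_eq (hT : IsDelayTree P β μ f ξ par) (hμ0 : ∀ᵐ x ∂μ, 0 ≤ x)
    (hf : ∀ k, 1 ≤ k → 0 < f k) {n : ℕ} (hn : 2 ≤ n) (k : ℕ) (h : (Finset.Icc 2 n → ℕ) → ℝ)
    {B : ℝ} (hB : ∀ᵐ ω ∂P, |h (treeAt par n ω)| ≤ B) :
    ∫ ω, h (treeAt par n ω) * (if deg (fun j => par j ω) (par (n + 1) ω) n = k then 1 else 0) ∂P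
      = ∫ ω, h (treeAt par n ω) * meanAttach f β μ (fun j => par j ω) k n ∂P := by
  have hrec := hT.ae_isRecursive hμ0
  have hTm := hT.measurable_treeAt n
  let g : ℕ → (Finset.Icc 2 n → ℕ) → ℝ := fun i t =>
    if deg (extendTree n t) i n = k then h t else 0
  have hgB : ∀ i, ∀ᵐ ω ∂P, |g i (treeAt par n ω)| ≤ B := fun i => by
    filter_upwards [hB] with ω hω
    simp only [g]
    split_ifs
    · exact hω
    · simpa using (abs_nonneg _).trans hω
  have hgeq : ∀ i ω, g i (treeAt par n ω)
      = if deg (fun j => par j ω) i n = k then h (treeAt par n ω) else 0 := fun i ω => by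
    simp only [g]
    rw [deg_congr (extendTree_treeAt par n ω) i le_rfl]
  let A : ℕ → Ω → ℝ := fun i ω => ∫ x, attachProb f (fun j => par j ω) (snapshot β n x) i ∂μ
  have hAm : ∀ i, Measurable (A i) := fun i => by
    have : A i = (fun t => ∫ x, attachProb f (extendTree n t) (snapshot β n x) i ∂μ)
        ∘ treeAt par n := by
      ext ω
      refine integral_congr_ae ?_
      filter_upwards [hμ0] with x hx
      exact attachProb_congr (extendTree_treeAt par n ω) i (snapshot_le (by omega) hx)
    rw [this]
    exact (measurable_of_countable _).comp hTm
  have hpint : ∀ ω, (IsRecursive fun j => par j ω) → ∀ i,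
      Integrable (fun x => attachProb f (fun j => par j ω) (snapshot β n x) i) μ := fun ω hr i => by
    refine integrable_of_ae_abs_le (B := 1) ((measurable_of_countable fun m =>
      attachProb f (fun j => par j ω) m i).comp (measurable_snapshot β n)).aestronglyMeasurable
      (ae_of_all _ fun x => ?_)
    rw [abs_of_nonneg (hr.attachProb_nonneg hf _ _)]
    exact hr.attachProb_le_one hf _ _
  have hA1 : ∀ i, ∀ᵐ ω ∂P, |A i ω| ≤ 1 := fun i => by
    filter_upwards [hrec] with ω hr
    rw [abs_of_nonneg (integral_nonneg fun x => hr.attachProb_nonneg hf _ _)]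
    have := integral_mono (hpint ω hr i) (integrable_const (1 : ℝ))
      fun x => hr.attachProb_le_one hf _ _
    simpa using this
  have hgm : ∀ i, Measurable fun ω => g i (treeAt par n ω) := fun i =>
    (measurable_of_countable (g i)).comp hTm
  calc _ = ∫ ω, ∑ i ∈ Finset.Icc 1 n, g i (treeAt par n ω)
          * ({ω | par (n + 1) ω = i}.indicator fun _ => (1 : ℝ)) ω ∂P := by
        refine integral_congr_ae ?_
        filter_upwards [hrec] with ω hr
        have hmem : par (n + 1) ω ∈ Finset.Icc 1 n := hr n (by omega)
        rw [Finset.sum_eq_single_of_mem _ hmem fun i _ hi => by simp [Ne.symm hi], hgeq]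
        simp
    _ = ∑ i ∈ Finset.Icc 1 n, ∫ ω, g i (treeAt par n ω)
          * ({ω | par (n + 1) ω = i}.indicator fun _ => (1 : ℝ)) ω ∂P := by
        refine integral_finsetSum _ fun i _ => integrable_of_ae_abs_le (B := B)
          ((hgm i).mul (measurable_const.indicator
            (hT.measurableSet_par_eq (n + 1) i))).aestronglyMeasurable ?_
        filter_upwards [hgB i] with ω hω
        by_cases hi : par (n + 1) ω = i
        · simpa [hi] using hω
        · simpa [hi] using (abs_nonneg _).trans hω
    _ = ∑ i ∈ Finset.Icc 1 n, ∫ ω, g i (treeAt par n ω) * A i ω ∂P :=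
        Finset.sum_congr rfl fun i _ => hT.integral_mul_par_eq hμ0 hf hn i (g i) (hgB i)
    _ = ∫ ω, ∑ i ∈ Finset.Icc 1 n, g i (treeAt par n ω) * A i ω ∂P := by
        refine (integral_finsetSum _ fun i _ => integrable_of_ae_abs_le (B := B)
          ((hgm i).mul (hAm i)).aestronglyMeasurable ?_).symm
        filter_upwards [hgB i, hA1 i] with ω h1 h2
        rw [Pi.mul_apply, abs_mul]
        nlinarith [abs_nonneg (g i (treeAt par n ω)), abs_nonneg (A i ω)]
    _ = _ := by
        refine integral_congr_ae ?_
        filter_upwards [hrec] with ω hr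
        simp only [meanAttach, attachDegProb]
        rw [integral_finsetSum _ fun i _ => ?_, Finset.mul_sum]
        · refine Finset.sum_congr rfl fun i _ => ?_
          rw [hgeq]
          split_ifs <;> simp [A]
        · split_ifs
          · exact hpint ω hr i
          · exact integrable_zero _ _ _

/-- The sum of the earlier noises is a bounded function of the tree at time `n`, hence orthogonal to
the next noise. -/
theorem ae_isLittleO_sum_noise (hT : IsDelayTree P β μ f ξ par) (hμ0 : ∀ᵐ x ∂μ, 0 ≤ x)
    (hf : ∀ k, 1 ≤ k → 0 < f k) (k : ℕ) :
    ∀ᵐ ω ∂P, (fun n => ∑ i ∈ Finset.range n, noise f β μ k (fun j => par j ω) i)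
      =o[atTop] fun n : ℕ => (n : ℝ) := by
  have hrec := hT.ae_isRecursive hμ0
  have hb : ∀ n, ∀ᵐ ω ∂P, |noise f β μ k (fun j => par j ω) n| ≤ 1 := fun n => by
    filter_upwards [hrec] with ω hr using hr.abs_noise_le hf k n
  refine ae_isLittleO_sum_of_orthogonal (fun n => ?_) hb fun n => ?_
  · have : (fun ω => noise f β μ k (fun j => par j ω) n)
        = (fun t => noise f β μ k (extendTree (n + 1) t) n) ∘ treeAt par (n + 1) := by
      ext ω
      exact noise_congr hμ0 le_rfl (extendTree_treeAt par (n + 1) ω) k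
    rw [this]
    exact (measurable_of_countable _).comp (hT.measurable_treeAt (n + 1))
  · rcases Nat.lt_or_ge n 2 with hn | hn
    · have : ∀ ω, noise f β μ k (fun j => par j ω) n = 0 := fun ω => if_neg (by omega)
      simp [this]
    let h : (Finset.Icc 2 n → ℕ) → ℝ := fun t =>
      ∑ i ∈ Finset.range n, noise f β μ k (extendTree n t) i
    have hh : ∀ ω, ∑ i ∈ Finset.range n, noise f β μ k (fun j => par j ω) i
        = h (treeAt par n ω) := fun ω => Finset.sum_congr rfl fun i hi =>
      noise_congr hμ0 (Finset.mem_range.1 hi) (extendTree_treeAt par n ω) k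
    have hB : ∀ᵐ ω ∂P, |h (treeAt par n ω)| ≤ n := by
      filter_upwards [hrec] with ω hr
      rw [← hh]
      calc _ ≤ ∑ i ∈ Finset.range n, |noise f β μ k (fun j => par j ω) i| :=
            Finset.abs_sum_le_sum_abs _ _
        _ ≤ ∑ i ∈ Finset.range n, (1 : ℝ) :=
            Finset.sum_le_sum fun i _ => hr.abs_noise_le hf k i
        _ = n := by simp
    have hhm : Measurable fun ω => h (treeAt par n ω) :=
      (measurable_of_countable h).comp (hT.measurable_treeAt n)
    let J : Ω → ℝ := fun ω => if deg (fun j => par j ω) (par (n + 1) ω) n = k then 1 else 0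
    have hJm : Measurable J := by
      have : J = (fun z : (Finset.Icc 2 n → ℕ) × ℕ =>
          if deg (extendTree n z.1) z.2 n = k then (1 : ℝ) else 0)
          ∘ fun ω => (treeAt par n ω, par (n + 1) ω) := by
        ext ω
        simp only [J, Function.comp]
        rw [deg_congr (extendTree_treeAt par n ω) _ le_rfl]
      rw [this]
      exact (measurable_of_countable _).comp
        ((hT.measurable_treeAt n).prodMk (hT.measurable_par (n + 1)))
    have hMm : Measurable fun ω => meanAttach f β μ (fun j => par j ω) k n := by
      have : (fun ω => meanAttach f β μ (fun j => par j ω) k n)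
          = (fun t => meanAttach f β μ (extendTree n t) k n) ∘ treeAt par n := by
        ext ω
        exact meanAttach_congr hμ0 (extendTree_treeAt par n ω) k (by omega)
      rw [this]
      exact (measurable_of_countable _).comp (hT.measurable_treeAt n)
    have e : ∀ ω, (∑ i ∈ Finset.range n, noise f β μ k (fun j => par j ω) i)
        * noise f β μ k (fun j => par j ω) n = h (treeAt par n ω) * J ω
          - h (treeAt par n ω) * meanAttach f β μ (fun j => par j ω) k n := fun ω => by
      rw [hh, noise, if_pos hn, mul_sub]
    simp_rw [e]
    rw [integral_sub, hT.integral_mul_deg_par_eq hμ0 hf hn k h hB, sub_self]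
    · refine integrable_of_ae_abs_le (B := n) (hhm.mul hJm).aestronglyMeasurable ?_
      filter_upwards [hB] with ω hω
      simp only [J]
      split_ifs
      · simpa using hω
      · simp
    · refine integrable_of_ae_abs_le (B := n) (hhm.mul hMm).aestronglyMeasurable ?_
      filter_upwards [hB, hrec] with ω hω hr
      have := meanAttach_mem (β := β) hr hf μ k n
      rw [abs_mul, abs_of_nonneg this.1]
      nlinarith [this.1, this.2, abs_nonneg (h (treeAt par n ω))]

end IsDelayTree

/-! ### Convergence of the total weight -/

section Convergence

variable {f : ℕ → ℝ} {p : ℕ → ℕ}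

theorem IsRecursive.tendsto_of_affine (hp : IsRecursive p) {α : ℝ}
    (hf : ∀ k : ℕ, 1 ≤ k → f k = k + α) :
    Tendsto (fun n : ℕ => totalWeight f p n / n) atTop (𝓝 (2 + α)) := by
  have h1 : Tendsto (fun n : ℕ => 2 + α - 2 * (1 / (n : ℝ))) atTop (𝓝 (2 + α)) := by
    simpa using (tendsto_one_div_atTop_nhds_zero_nat.const_mul (2 : ℝ)).const_sub (2 + α)
  refine h1.congr' ?_
  filter_upwards [eventually_ge_atTop 2] with n hn
  have hn0 : (0 : ℝ) < n := by exact_mod_cast (by omega : 0 < n)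
  have h2 : ∑ i ∈ Finset.Icc 1 n, (deg p i n : ℝ) + 2 = 2 * n := by exact_mod_cast hp.sum_deg hn
  have h3 : totalWeight f p n = ∑ i ∈ Finset.Icc 1 n, (deg p i n : ℝ) + α * n := by
    rw [totalWeight, Finset.sum_congr rfl fun i _ => hf _ (hp.one_le_deg i n),
      Finset.sum_add_distrib, Finset.sum_const, Nat.card_Icc]
    simp [mul_comm]
  rw [h3, eq_sub_of_add_eq h2]
  field_simp
  ring

theorem flux_tailCount (f : ℕ → ℝ) (p : ℕ → ℕ) (k n : ℕ) :
    flux f (fun k n => (tailCount p k n : ℝ)) (totalWeight f p) (k + 1) n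
      = f (k + 1) * degCount p (k + 1) n := by
  simp only [flux, ← IsRecursive.tailCount_add_degCount p k n]
  push_cast
  ring

theorem IsRecursive.fluidData (hp : IsRecursive p) (hf : AttachAssumption f)
    (hs : IsSublinear f) {β : ℝ} {μ : Measure ℝ}
    (hnoise : ∀ k, (fun n => ∑ i ∈ Finset.range n, noise f β μ k p i)
      =o[atTop] fun n : ℕ => (n : ℝ))
    (hmean : ∀ k, 1 ≤ k → Tendsto (fun n => meanAttach f β μ p k n
      - f k * degCount p k n / totalWeight f p n) atTop (𝓝 0)) :
    ∃ c C, FluidData f (fun k n => (tailCount p k n : ℝ)) (totalWeight f p) c C := by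
  obtain ⟨c, hc, hfc⟩ := hf.inf_pos
  obtain ⟨C, hC⟩ := hf.linear_growth
  have hC0 : 0 ≤ C := by
    have h1 := hC 1 le_rfl
    have h2 := hf.pos 1 le_rfl
    simp only [Nat.cast_one, mul_one] at h1
    linarith
  refine ⟨c, 2 * C, hf.pos, hc, fun n => by rw [hp.tailCount_zero], fun k n => ?_,
    hp.le_totalWeight hfc, hp.totalWeight_le hC hC0, fun ε hε => ?_, fun k => ?_⟩
  -- The increments are at most 1 from time 2 on; the bound 2 spares an analysis of the first two
  -- steps.
  · rcases Nat.lt_or_ge n 2 with hn | hn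
    · have h1 : (tailCount p k (n + 1) : ℝ) ≤ 2 := by
        exact_mod_cast (IsRecursive.tailCount_le p k (n + 1)).trans (by omega)
      have h2 : (tailCount p k n : ℝ) ≤ 2 := by
        exact_mod_cast (IsRecursive.tailCount_le p k n).trans (by omega)
      have h3 : (0 : ℝ) ≤ tailCount p k (n + 1) := by positivity
      have h4 : (0 : ℝ) ≤ tailCount p k n := by positivity
      rw [abs_le]
      constructor <;> linarith
    · cases k with
      | zero => rw [hp.tailCount_zero, hp.tailCount_zero]; norm_num
      | succ k =>
        rw [hp.tailCount_succ k hn]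
        split_ifs <;> norm_num
  · obtain ⟨K₀, hK₀⟩ := hs.exists_le (half_pos hε)
    refine ⟨K₀, fun K hK => Eventually.of_forall fun n => ?_⟩
    simp_rw [flux_tailCount]
    have := hp.totalWeight_tail hf.pos (half_pos hε).le (K := K)
      (fun d hd => hK₀ d (by omega)) n
    linarith
  · let N : ℕ → ℝ := fun n => (tailCount p (k + 1) n : ℝ)
    let r : ℕ → ℝ := fun n => f (k + 1) * degCount p (k + 1) n / totalWeight f p n
    -- From time 2 on this is exactly the error of `meanAttach` against the undelayed proportion;
    -- its partial sums are `o(n)` by Cesàro averaging.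
    let δ : ℕ → ℝ := fun n => N (n + 1) - N n - r n - noise f β μ (k + 1) p n
    have hδ : Tendsto δ atTop (𝓝 0) := by
      refine (hmean (k + 1) (by omega)).congr' ?_
      filter_upwards [eventually_ge_atTop 2] with n hn
      simp only [δ, N, r, noise, if_pos hn, hp.tailCount_succ k hn]
      push_cast
      ring
    have h1 := (hnoise (k + 1)).add (Asymptotics.isLittleO_sum_range_of_tendsto_zero hδ)
    refine h1.congr_left fun n => ?_
    have hN0 : N 0 = 0 := by simp [N, tailCount]
    have h2 : ∑ j ∈ Finset.range n, (N (j + 1) - N j) = N n := by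
      rw [Finset.sum_range_sub, hN0, sub_zero]
    simp_rw [flux_tailCount]
    simp only [δ, Finset.sum_sub_distrib] at h2 ⊢
    simp only [N, r] at h2 ⊢
    linarith

end Convergence

end DelayPA

/-! ### The main theorem -/

theorem lemma4p2 {Ω : Type*} [MeasurableSpace Ω] (P : Measure Ω) [IsProbabilityMeasure P]
    (β : ℝ) (hβ0 : 0 ≤ β) (hβ1 : β < 1)
    (μ : Measure ℝ) [IsProbabilityMeasure μ] (hμ0 : ∀ᵐ x ∂μ, 0 ≤ x)
    (f : ℕ → ℝ) (hf : DelayPA.AttachAssumption f) (hreg : DelayPA.AttachRegime f)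
    (hμ : DelayPA.DelayAssumption β μ)
    (ξ : ℕ → Ω → ℝ) (par : ℕ → Ω → ℕ) (hT : DelayPA.IsDelayTree P β μ f ξ par) :
    (∃! l : ℝ, 0 < l ∧ DelayPA.rhoHat f l = 1) ∧
    ∀ lam : ℝ, 0 < lam → DelayPA.rhoHat f lam = 1 →
      ∀ᵐ ω ∂P,
        (∀ n : ℕ, 1 ≤ n →
          HasSum (fun k : ℕ => f (k + 1) * (DelayPA.degCount (fun j => par j ω) (k + 1) n : ℝ))
            (DelayPA.totalWeight f (fun j => par j ω) n)) ∧
        Tendsto (fun n : ℕ => DelayPA.totalWeight f (fun j => par j ω) n / n) atTop (𝓝 lam) := by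
  have hf0 := hf.pos
  have hrec := hT.ae_isRecursive hμ0
  refine ⟨DelayPA.existsUnique_rhoHat_eq_one hf, fun lam hlam hlam1 => ?_⟩
  rw [DelayPA.rhoHat_eq_one_iff hf0 hlam] at hlam1
  suffices h : ∀ᵐ ω ∂P,
      Tendsto (fun n : ℕ => DelayPA.totalWeight f (fun j => par j ω) n / n) atTop (𝓝 lam) by
    filter_upwards [hrec, h] with ω hr hω
    exact ⟨fun n _ => DelayPA.hasSum_totalWeight f hr n, hω⟩
  by_cases hs : DelayPA.IsSublinear f
  · have hnoise := ae_all_iff.2 fun k => hT.ae_isLittleO_sum_noise hμ0 hf0 k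
    obtain ⟨c, hc, hfc⟩ := hf.inf_pos
    -- From here on the argument is pathwise; the delay estimate holds for all recursive trees and
    -- adds no exceptional set.
    filter_upwards [hrec, hnoise] with ω hr hn
    have hmean : ∀ k, 1 ≤ k → Tendsto (fun n => DelayPA.meanAttach f β μ (fun j => par j ω) k n
        - f k * DelayPA.degCount (fun j => par j ω) k n
          / DelayPA.totalWeight f (fun j => par j ω) n) atTop (𝓝 0) := by
      intro k hk
      rw [Metric.tendsto_nhds]
      intro ε hε
      filter_upwards [DelayPA.eventually_meanAttach_sub_le hβ1 μ hμ0 hc hfc hs hk (half_pos hε)]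
        with n hn
      rw [Real.dist_eq, sub_zero]
      linarith [hn _ hr]
    obtain ⟨c, C, hfl⟩ := hr.fluidData hf hs hn hmean
    exact hfl.tendsto_div fun L hL h => DelayPA.hasSum_rhoTerm_injective hf0 hL hlam h hlam1
  · obtain ⟨α, hα⟩ : DelayPA.IsAffine f := hreg.resolve_right fun h => h.elim
      (fun h => hs h.1) fun h => hs h.1
    have hα1 : 0 < 1 + α := by simpa [hα 1 le_rfl] using hf0 1 le_rfl
    obtain rfl : lam = 2 + α := DelayPA.hasSum_rhoTerm_injective hf0 hlam (by linarith) hlam1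
      (DelayPA.hasSum_rhoTerm_affine hα1 hα)
    filter_upwards [hrec] with ω hr using hr.tendsto_of_affine hα
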